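/- Let $\gamma\in(0,1)$ with $\gamma^{-1}\notin\mathbb N$ and put $N=\lfloor\gamma^{-1}\rfloor$. A path $x:[0,1]\to\mathbb R$ is $\gamma$-Hölder if $|x_t-x_s|\le C|t-s|^\gamma$ for some $C$ and all $s,t\in[0,1]$. **Setting.** Let $\mathcal H=\bigoplus_{n\ge0}\mathcal H_{(n)}$ be a locally finite graded connected Hopf algebra over $\mathbb R$: $\mathcal H_{(0)}=\mathbb R\mathbf 1$, every $\mathcal H_{(n)}$ is finite-dimensional, $\mathcal H_{(n)}\mathcal H_{(m)}\subset\mathcal H_{(n+m)}$ and $\Delta\mathcal H_{(n)}\subset\bigoplus_{p+q=n}\mathcal H_{(p)}\otimes\mathcal H_{(q)}$; let $\varepsilon$ be its counit and $S$ its antipode. Write $\mathcal H_N=\bigoplus_{k\le N}\mathcal H_{(k)}$ and identify $\mathcal H_N^*$ with the functionals on $\mathcal H$ vanishing in degrees $>N$; it is an algebra for $\langle f\star g,x\rangle=\langle f\otimes g,\Delta x\rangle$, $x\in\mathcal H_N$. Let $\mathfrak g^N$ be the set of those $\alpha\in\mathcal H_N^*$ that are infinitesimal characters, i.e. $\alpha(xy)=\alpha(x)\varepsilon(y)+\varepsilon(x)\alpha(y)$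 for all $x,y\in\mathcal H$, and let $G^N=\exp_N(\mathfrak g^N)$, where $\exp_N(\alpha)=\sum_{k=0}^N\alpha^{\star k}/k!$ in $\mathcal H_N^*$. The inverse in the group $G^N$ is $X^{-1}=X\circ S$. Fix a basis of each $\mathcal H_{(n)}$, let $B$ be the resulting homogeneous basis of $\mathcal H_N$, and let $\{e_1,\dots,e_d\}=B\cap\mathcal H_{(1)}$, $d=\dim\mathcal H_{(1)}$. Put $D=\max_{v\in B}\sum|c(v_1,v_2;v)|$, where $\Delta v=\sum c(v_1,v_2;v)\,v_1\otimes v_2$ with $v_1,v_2\in B$. For $X\in G^N$ with component $X_k=X|_{\mathcal H_{(k)}}$ in degree $k$ put $\|X_k\|=D\max_{v\in B\cap\mathcal H_{(k)}}|\langle X,v\rangle|$, $$|X|=\max_{1\le k\le N}\bigl(k!\,\|X_k\|\bigr)^{1/k}+\max_{1\le k\le N}\bigl(k!\,\|(X^{-1})_k\|\bigr)^{1/k},\qquad \rho_N(X,Y)=|Y^{-1}\star X|.$$ An *$(\mathcal H,\gamma)$-Hölder path* is a map $\mathbb X:[0,1]\to G^N$ with $\mathbb X_0=\varepsilon$ such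 that, for some $C$, $\rho_N(\mathbb X_s,\mathbb X_t)\le C|t-s|^\gamma$ for all $s,t\in[0,1]$. **(1)** For every such $\mathcal H$, every choice of the bases and all $\gamma$-Hölder paths $x^1,\dots,x^d:[0,1]\to\mathbb R$ there is an $(\mathcal H,\gamma)$-Hölder path $\mathbb X$ with $$\langle\mathbb X_t,e_i\rangle=x^i_t-x^i_0\qquad(t\in[0,1],\ i=1,\dots,d);$$ in particular $\langle\mathbb X_t,e_i\rangle=x^i_t$ when $x^i_0=0$. **(2)** Let $d\ge0$ and let $\mathcal H_{\rm BCK}$ be the Butcher–Connes–Kreimer Hopf algebra: the free commutative algebra over the non-planar rooted trees with nodes decorated by $\{1,\dots,d\}$, its coproduct being the algebra morphism determined by $\Delta[\tau]_i=[\tau]_i\otimes\mathbf 1+(\mathrm{id}\otimes[\cdot]_i)\Delta\tau$, where $[\tau]_i$ is the tree obtained by grafting the forest $\tau$ to a new root decorated by $i$. For all $\gamma$-Hölder paths $x^1,\dots,x^d:[0,1]\to\mathbb R$ there is a branched $\gamma$-rough path $X$ over $(x^1,\dots,x^d)$, i.e. a map $X$ from $[0,1]^2$ to the characters of $\mathcal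 H_{\rm BCK}$ such that - $X_{tt}=\varepsilon$ and $X_{su}\star X_{ut}=X_{st}$ for all $s,u,t\in[0,1]$; - for every forest $\tau$ with $|\tau|$ nodes there is $C$ with $|\langle X_{st},\tau\rangle|\le C|t-s|^{\gamma|\tau|}$ for all $s,t\in[0,1]$; - $\langle X_{st},\bullet_i\rangle=x^i_t-x^i_s$ for all $s,t\in[0,1]$ and $i=1,\dots,d$, where $\bullet_i$ is the tree with a single node, decorated by $i$. -/

import Mathlib

open scoped TensorProduct unitInterval

/-! ### Graded connected Hopf algebras and their truncated character groups -/

section General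

variable {H : Type*} [Ring H] [HopfAlgebra ℝ H]

/-- A grading `𝒜` of a Hopf algebra `H` (compatible with the product through `GradedAlgebra 𝒜`)
makes `H` a locally finite graded connected Hopf algebra: `𝒜 0 = ℝ 1`, every `𝒜 n` is finite
dimensional and `Δ (𝒜 n) ⊆ ⨁_{p + q = n} 𝒜 p ⊗ 𝒜 q`. -/
class IsLocallyFiniteConnectedHopf (𝒜 : ℕ → Submodule ℝ H) [GradedAlgebra 𝒜] : Prop where
  connected : 𝒜 0 = Submodule.span ℝ {(1 : H)}
  locallyFinite : ∀ n, Module.Finite ℝ (𝒜 n)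
  comul_mem : ∀ n, ∀ x ∈ 𝒜 n, Coalgebra.comul (R := ℝ) x ∈
    ⨆ (p : ℕ) (q : ℕ) (_ : p + q = n),
      LinearMap.range (TensorProduct.map (𝒜 p).subtype (𝒜 q).subtype)

variable (𝒜 : ℕ → Submodule ℝ H) [GradedAlgebra 𝒜]

/-- The product `⋆` of the dual of `H`: `⟨f ⋆ g, x⟩ = ⟨f ⊗ g, Δ x⟩`. -/
noncomputable def starProd (f g : H →ₗ[ℝ] ℝ) : H →ₗ[ℝ] ℝ :=
  (WithConv.toConv f * WithConv.toConv g).ofConv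

/-- The power `f ⋆ ⋯ ⋆ f` (`k` factors); it is the counit `ε` for `k = 0`. -/
noncomputable def starPow (f : H →ₗ[ℝ] ℝ) (k : ℕ) : H →ₗ[ℝ] ℝ :=
  (WithConv.toConv f ^ k).ofConv

/-- The projection of `H` onto `H_N = ⨁_{k ≤ N} 𝒜 k`. -/
noncomputable def gradedProj (N : ℕ) : H →ₗ[ℝ] H :=
  ∑ k ∈ Finset.range (N + 1), GradedAlgebra.proj 𝒜 k

/-- Truncation of functionals. The dual of `H_N` is identified with the space of the functionals
on `H` that vanish in all degrees `> N`. -/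
noncomputable def dualTrunc (N : ℕ) (f : H →ₗ[ℝ] ℝ) : H →ₗ[ℝ] ℝ :=
  f ∘ₗ gradedProj 𝒜 N

/-- Infinitesimal characters of `H`. -/
def IsInfChar (α : H →ₗ[ℝ] ℝ) : Prop :=
  ∀ x y : H, α (x * y) =
    α x * Coalgebra.counit (R := ℝ) y + Coalgebra.counit (R := ℝ) x * α y

/-- The truncated Lie algebra `𝔤^N`: the infinitesimal characters that vanish in degrees `> N`. -/
def truncLie (N : ℕ) : Set (H →ₗ[ℝ] ℝ) :=
  {α | IsInfChar α ∧ ∀ n, N < n → ∀ x ∈ 𝒜 n, α x = 0}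

/-- The truncated exponential `exp_N α = ∑_{k ≤ N} α^{⋆ k} / k!`, as a functional on `H_N`. -/
noncomputable def truncExp (N : ℕ) (α : H →ₗ[ℝ] ℝ) : H →ₗ[ℝ] ℝ :=
  dualTrunc 𝒜 N (∑ k ∈ Finset.range (N + 1), ((k.factorial : ℝ)⁻¹) • starPow α k)

/-- The truncated group `G^N = exp_N (𝔤^N)`. -/
def truncGroup (N : ℕ) : Set (H →ₗ[ℝ] ℝ) := truncExp 𝒜 N '' truncLie 𝒜 N

/-- The product of `G^N` (the product of the algebra dual to the coalgebra `H_N`). -/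
noncomputable def truncMul (N : ℕ) (X Y : H →ₗ[ℝ] ℝ) : H →ₗ[ℝ] ℝ :=
  dualTrunc 𝒜 N (starProd X Y)

/-- The inverse `X⁻¹ = X ∘ S` in `G^N`. -/
noncomputable def dualInv (X : H →ₗ[ℝ] ℝ) : H →ₗ[ℝ] ℝ :=
  X ∘ₗ HopfAlgebra.antipode ℝ (A := H)

variable (b : ∀ n, Module.Basis (Fin (Module.finrank ℝ (𝒜 n))) ℝ (𝒜 n))

/-- The homogeneous basis of `H` made of the bases `b n` of the homogeneous components. -/
noncomputable def homBasis :
    Module.Basis (Σ n, Fin (Module.finrank ℝ (𝒜 n))) ℝ H :=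
  (DirectSum.Decomposition.isInternal 𝒜).collectedBasis b

/-- `∑ |c(v₁, v₂; v)|`, where `Δ v = ∑ c(v₁, v₂; v) v₁ ⊗ v₂` in the homogeneous basis. -/
noncomputable def comulCoeffSum (v : H) : ℝ :=
  (((homBasis 𝒜 b).tensorProduct (homBasis 𝒜 b)).repr (Coalgebra.comul (R := ℝ) v)).sum
    fun _ c => |c|

/-- The constant `D = max_v ∑ |c(v₁, v₂; v)|`, over the basis vectors `v` of `H_N`. -/
noncomputable def normConst (N : ℕ) : ℝ :=
  ⨆ v : Σ k : Fin (N + 1), Fin (Module.finrank ℝ (𝒜 k)), comulCoeffSum 𝒜 b (b v.1 v.2 : H)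

/-- The norm `D ‖f_k‖_∞` of the component `f_k` in degree `k` of a functional `f`, where
`‖ ‖_∞` is the maximum of the absolute values on the basis vectors. -/
noncomputable def levelNorm (N k : ℕ) (f : H →ₗ[ℝ] ℝ) : ℝ :=
  normConst 𝒜 b N * ⨆ i, |f (b k i : H)|

/-- The homogeneous norm
`|X| = max_{1 ≤ k ≤ N} (k! ‖X_k‖)^{1/k} + max_{1 ≤ k ≤ N} (k! ‖(X⁻¹)_k‖)^{1/k}` on `G^N`. -/
noncomputable def homNorm (N : ℕ) (X : H →ₗ[ℝ] ℝ) : ℝ :=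
  (⨆ k : Fin N, ((((k : ℕ) + 1).factorial : ℝ) * levelNorm 𝒜 b N ((k : ℕ) + 1) X) ^
      (1 / (((k : ℕ) : ℝ) + 1))) +
    ⨆ k : Fin N, ((((k : ℕ) + 1).factorial : ℝ) *
      levelNorm 𝒜 b N ((k : ℕ) + 1) (dualInv X)) ^ (1 / (((k : ℕ) : ℝ) + 1))

/-- The left-invariant distance `ρ_N (X, Y) = |Y⁻¹ ⋆ X|` on `G^N`. -/
noncomputable def truncDist (N : ℕ) (X Y : H →ₗ[ℝ] ℝ) : ℝ :=
  homNorm 𝒜 b N (truncMul 𝒜 N (dualInv Y) X)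

/-- `(H, γ)`-Hölder paths: paths `X : [0,1] → G^N`, `N = ⌊1/γ⌋`, that start at `ε` and are
`γ`-Hölder for the distance `ρ_N`. -/
structure IsHopfHolderPath (γ : ℝ) (X : I → H →ₗ[ℝ] ℝ) : Prop where
  mem : ∀ t, X t ∈ truncGroup 𝒜 ⌊γ⁻¹⌋₊
  zero : X 0 = Coalgebra.counit
  holder : ∃ C : ℝ, ∀ s t : I,
    truncDist 𝒜 b ⌊γ⁻¹⌋₊ (X s) (X t) ≤ C * |(t : ℝ) - s| ^ γ

end General

/-- Real-valued `γ`-Hölder paths on `[0,1]`. -/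
def IsHolderFun (γ : ℝ) (x : I → ℝ) : Prop :=
  ∃ C : ℝ, ∀ s t : I, |x t - x s| ≤ C * |(t : ℝ) - s| ^ γ

/-! ### Decorated non-planar rooted trees -/

/-- Planar rooted trees with nodes decorated by `A`: a root and the list of its branches. -/
inductive PlanarTree (A : Type) : Type
  | node : A → List (PlanarTree A) → PlanarTree A

namespace PlanarTree

variable {A : Type}

/-- Two planar trees are isomorphic as decorated rooted trees: the equivalence relation generated
by permuting the branches at an arbitrary node. -/
inductive Iso : PlanarTree A → PlanarTree A → Prop
  | refl (t) : Iso t t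
  | symm {t u} : Iso t u → Iso u t
  | trans {t u v} : Iso t u → Iso u v → Iso t v
  | perm (a : A) {l m : List (PlanarTree A)} : l.Perm m → Iso (node a l) (node a m)
  | branch (a : A) {t u : PlanarTree A} (l : List (PlanarTree A)) :
      Iso t u → Iso (node a (t :: l)) (node a (u :: l))

instance setoid (A : Type) : Setoid (PlanarTree A) :=
  ⟨Iso, Iso.refl, Iso.symm, Iso.trans⟩

mutual
/-- The number of nodes of a planar tree. -/
def size : PlanarTree A → ℕ
  | node _ l => sizeList l + 1
/-- The number of nodes of a list of planar trees. -/
def sizeList : List (PlanarTree A) → ℕ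
  | [] => 0
  | t :: l => size t + sizeList l
end

theorem sizeList_eq (l : List (PlanarTree A)) : sizeList l = (l.map size).sum := by
  induction l with
  | nil => simp [sizeList]
  | cons t l ih => simp [sizeList, ih]

theorem size_eq_of_iso {t u : PlanarTree A} (h : Iso t u) : size t = size u := by
  induction h with
  | refl t => rfl
  | symm _ ih => exact ih.symm
  | trans _ _ ih₁ ih₂ => exact ih₁.trans ih₂
  | perm a h => simp [size, sizeList_eq, (h.map size).sum_eq]
  | branch a l _ ih => simp [size, sizeList, ih]

theorem iso_node_of_forall₂ (a : A) {l m : List (PlanarTree A)} (h : List.Forall₂ Iso l m) :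
    Iso (node a l) (node a m) := by
  have key : ∀ l m : List (PlanarTree A), List.Forall₂ Iso l m → ∀ k : List (PlanarTree A),
      Iso (node a (l ++ k)) (node a (m ++ k)) := by
    intro l m h
    induction h with
    | nil => intro k; exact Iso.refl _
    | @cons t u l m htu _ ih =>
      intro k
      refine (Iso.branch a (l ++ k) htu).trans ?_
      refine (Iso.perm a (List.perm_middle (l₁ := l) (l₂ := k) (a := u)).symm).trans ?_
      exact (ih (u :: k)).trans (Iso.perm a List.perm_middle)
  simpa using key l m h []

/-- Induction over planar trees, the hypothesis holding for all branches. -/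
theorem induct {P : PlanarTree A → Prop}
    (h : ∀ a l, (∀ t ∈ l, P t) → P (node a l)) (t : PlanarTree A) : P t :=
  PlanarTree.rec (motive_1 := P) (motive_2 := fun l => ∀ t ∈ l, P t) h
    (by simp) (fun t l ht hl => by simpa using ⟨ht, hl⟩) t

end PlanarTree

/-- Non-planar rooted trees with nodes decorated by `A`. -/
def DecTree (A : Type) : Type := Quotient (PlanarTree.setoid A)

namespace DecTree

variable {A : Type}

/-- The non-planar tree underlying a planar tree. -/
def mk (t : PlanarTree A) : DecTree A := Quotient.mk _ t

/-- A planar representative of a tree. -/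
noncomputable def out (τ : DecTree A) : PlanarTree A := Quotient.out τ

/-- The number `|τ|` of nodes of a tree. -/
def size (τ : DecTree A) : ℕ :=
  Quotient.lift PlanarTree.size (fun _ _ h => PlanarTree.size_eq_of_iso h) τ

/-- The tree `[τ₁ ⋯ τₖ]_a` obtained by grafting the trees of the forest `τ₁ ⋯ τₖ` to a new root
decorated by `a`. -/
noncomputable def graft (a : A) (f : Multiset (DecTree A)) : DecTree A :=
  mk (PlanarTree.node a (f.toList.map out))

theorem forall₂_out (l : List (PlanarTree A)) :
    List.Forall₂ PlanarTree.Iso ((l.map mk).map out) l := by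
  induction l with
  | nil => exact List.Forall₂.nil
  | cons t l ih => exact List.Forall₂.cons (Quotient.mk_out t) ih

theorem graft_map_mk (a : A) (l : List (PlanarTree A)) :
    graft a (l.map mk : Multiset (DecTree A)) = mk (PlanarTree.node a l) := by
  have hp : ((l.map mk : Multiset (DecTree A)).toList).Perm (l.map mk) := by
    rw [← Multiset.coe_eq_coe, Multiset.coe_toList]
  exact Quotient.sound ((PlanarTree.Iso.perm a (hp.map out)).trans
    (PlanarTree.iso_node_of_forall₂ a (forall₂_out l)))

theorem exists_map_mk (f : Multiset (DecTree A)) :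
    ∃ l : List (PlanarTree A), f = (l.map mk : Multiset (DecTree A)) := by
  refine ⟨f.toList.map out, ?_⟩
  have h : mk ∘ out = (id : DecTree A → DecTree A) := funext fun τ => Quotient.out_eq τ
  rw [List.map_map, h, List.map_id, Multiset.coe_toList]

/-- The tree with a single node, decorated by `a`. -/
noncomputable def single (a : A) : DecTree A := graft a 0

end DecTree

/-! ### The Butcher–Connes–Kreimer Hopf algebra -/

/-- The free commutative algebra over the set of decorated rooted trees. Its basis of monomials is
the set of decorated forests. -/
def BCK (A : Type) : Type := MvPolynomial (DecTree A) ℝ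

namespace BCK

variable {A : Type}

noncomputable instance : CommRing (BCK A) :=
  inferInstanceAs (CommRing (MvPolynomial (DecTree A) ℝ))

noncomputable instance : Algebra ℝ (BCK A) :=
  inferInstanceAs (Algebra ℝ (MvPolynomial (DecTree A) ℝ))

/-- A tree, as an element of the algebra. -/
noncomputable def tree (τ : DecTree A) : BCK A :=
  MvPolynomial.X (R := ℝ) τ

/-- A forest `τ₁ ⋯ τₖ` (a multiset of trees), as an element of the algebra. -/
noncomputable def forest (f : Multiset (DecTree A)) : BCK A := (f.map tree).prod

/-- The algebra morphism with given values on trees. -/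
noncomputable def liftAlg {B : Type*} [CommRing B] [Algebra ℝ B] (φ : DecTree A → B) :
    BCK A →ₐ[ℝ] B :=
  MvPolynomial.aeval (R := ℝ) φ

@[simp] theorem liftAlg_tree {B : Type*} [CommRing B] [Algebra ℝ B] (φ : DecTree A → B)
    (τ : DecTree A) : liftAlg φ (tree τ) = φ τ :=
  MvPolynomial.aeval_X (R := ℝ) φ τ

theorem algHom_ext {B : Type*} [CommRing B] [Algebra ℝ B] {φ ψ : BCK A →ₐ[ℝ] B}
    (h : ∀ τ, φ (tree τ) = ψ (tree τ)) : φ = ψ :=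
  MvPolynomial.algHom_ext (R := ℝ) h

open Classical in
/-- The basis of forests. -/
noncomputable def forestBasis : Module.Basis (Multiset (DecTree A)) ℝ (BCK A) :=
  (MvPolynomial.basisMonomials (DecTree A) ℝ).reindex Multiset.toFinsupp.symm.toEquiv

theorem forestBasis_apply (f : Multiset (DecTree A)) : forestBasis f = forest f := by
  classical
  have h : ∀ f : Multiset (DecTree A),
      MvPolynomial.monomial (Multiset.toFinsupp f) (1 : ℝ) = forest f := by
    intro f
    induction f using Multiset.induction with
    | empty => simp [forest]; rfl
    | cons τ f ih =>
      rw [← Multiset.singleton_add, map_add, ← one_mul (1 : ℝ), ← MvPolynomial.monomial_mul, ih]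
      rw [forest, forest, Multiset.singleton_add, Multiset.map_cons, Multiset.prod_cons]
      simp [tree, MvPolynomial.X]
      rfl
  rw [← h]
  exact (Module.Basis.reindex_apply (M := MvPolynomial (DecTree A) ℝ)
    (MvPolynomial.basisMonomials (DecTree A) ℝ) Multiset.toFinsupp.symm.toEquiv f).trans
    (congrFun (MvPolynomial.coe_basisMonomials (DecTree A) ℝ) _)

/-- The linear map `[·]_a` that grafts a forest to a new root decorated by `a`. -/
noncomputable def graftLin (a : A) : BCK A →ₗ[ℝ] BCK A :=
  forestBasis.constr ℝ fun f => tree (DecTree.graft a f)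

theorem graftLin_forest (a : A) (f : Multiset (DecTree A)) :
    graftLin a (forest f) = tree (DecTree.graft a f) := by
  rw [← forestBasis_apply, graftLin, Module.Basis.constr_basis]

mutual
/-- The coproduct of a planar tree:
`Δ [τ₁ ⋯ τₖ]_a = [τ₁ ⋯ τₖ]_a ⊗ 1 + (id ⊗ [·]_a) (Δ τ₁ ⋯ Δ τₖ)`. -/
noncomputable def comulPlanar : PlanarTree A → BCK A ⊗[ℝ] BCK A
  | .node a l => tree (DecTree.mk (.node a l)) ⊗ₜ[ℝ] 1 +
      (graftLin a).lTensor (BCK A) (comulPlanarList l)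
/-- The product of the coproducts of a list of planar trees. -/
noncomputable def comulPlanarList : List (PlanarTree A) → BCK A ⊗[ℝ] BCK A
  | [] => 1
  | t :: l => comulPlanar t * comulPlanarList l
end

theorem comulPlanarList_eq (l : List (PlanarTree A)) :
    comulPlanarList l = (l.map comulPlanar).prod := by
  induction l with
  | nil => simp [comulPlanarList]
  | cons t l ih => simp [comulPlanarList, ih]

theorem comulPlanar_eq_of_iso {t u : PlanarTree A} (h : PlanarTree.Iso t u) :
    comulPlanar t = comulPlanar u := by
  induction h with
  | refl t => rfl
  | symm _ ih => exact ih.symm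
  | trans _ _ ih₁ ih₂ => exact ih₁.trans ih₂
  | @perm a l m h =>
    have h' : DecTree.mk (PlanarTree.node a l) = DecTree.mk (PlanarTree.node a m) :=
      Quotient.sound (PlanarTree.Iso.perm a h)
    simp only [comulPlanar, comulPlanarList_eq, h', (h.map comulPlanar).prod_eq]
  | @branch a t u l h ih =>
    have h' : DecTree.mk (PlanarTree.node a (t :: l)) = DecTree.mk (PlanarTree.node a (u :: l)) :=
      Quotient.sound (PlanarTree.Iso.branch a l h)
    simp only [comulPlanar, comulPlanarList, h', ih]

/-- The coproduct of a tree. -/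
noncomputable def comulTree (τ : DecTree A) : BCK A ⊗[ℝ] BCK A :=
  Quotient.lift comulPlanar (fun _ _ h => comulPlanar_eq_of_iso h) τ

/-- The coproduct, as an algebra morphism. -/
noncomputable def comulHom : BCK A →ₐ[ℝ] BCK A ⊗[ℝ] BCK A := liftAlg comulTree

/-- The counit: `1` on the empty forest and `0` on the other forests. -/
noncomputable def counitHom : BCK A →ₐ[ℝ] ℝ := liftAlg fun _ => 0

/-- Induction over trees. -/
theorem tree_induct {P : DecTree A → Prop}
    (h : ∀ a (f : Multiset (DecTree A)), (∀ τ ∈ f, P τ) → P (DecTree.graft a f))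
    (τ : DecTree A) : P τ := by
  induction τ using Quotient.inductionOn with
  | h t =>
    refine PlanarTree.induct (P := fun t => P (DecTree.mk t)) ?_ t
    intro a l hl
    rw [← DecTree.graft_map_mk]
    apply h
    simpa using hl

/-- `Δ [x]_a = [x]_a ⊗ 1 + (id ⊗ [·]_a) Δ x`. -/
theorem comulHom_graftLin (a : A) (x : BCK A) :
    comulHom (graftLin a x) =
      graftLin a x ⊗ₜ[ℝ] 1 + (graftLin a).lTensor (BCK A) (comulHom x) := by
  have h : comulHom.toLinearMap ∘ₗ graftLin a =
      (TensorProduct.mk ℝ (BCK A) (BCK A)).flip 1 ∘ₗ graftLin a +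
        (graftLin a).lTensor (BCK A) ∘ₗ (comulHom (A := A)).toLinearMap := by
    refine forestBasis.ext fun f => ?_
    obtain ⟨l, rfl⟩ := DecTree.exists_map_mk f
    have hl : comulHom (forest (l.map DecTree.mk : Multiset (DecTree A))) = comulPlanarList l := by
      rw [comulPlanarList_eq, forest, map_multiset_prod]
      simp [comulHom, Function.comp_def]
      rfl
    simp only [forestBasis_apply, LinearMap.comp_apply, LinearMap.add_apply, graftLin_forest,
      AlgHom.toLinearMap_apply, hl, DecTree.graft_map_mk, LinearMap.flip_apply,
      TensorProduct.mk_apply]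
    rw [comulHom, liftAlg_tree]
    exact comulPlanar.eq_1 a l
  exact LinearMap.congr_fun h x

theorem counitHom_graftLin (a : A) (x : BCK A) : counitHom (graftLin a x) = 0 := by
  have h : counitHom.toLinearMap ∘ₗ graftLin a = 0 := by
    refine forestBasis.ext fun f => ?_
    simp [forestBasis_apply, graftLin_forest, counitHom]
  exact LinearMap.congr_fun h x

/-- Two algebra morphisms agree if they agree on `[x]_a` whenever they agree on `x`. -/
theorem algHom_ext_graft {B : Type*} [CommRing B] [Algebra ℝ B] {φ ψ : BCK A →ₐ[ℝ] B}
    (h : ∀ a x, φ x = ψ x → φ (graftLin a x) = ψ (graftLin a x)) : φ = ψ := by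
  refine algHom_ext fun τ => ?_
  refine tree_induct (P := fun τ => φ (tree τ) = ψ (tree τ)) ?_ τ
  intro a f hf
  rw [← graftLin_forest]
  apply h
  rw [forest, map_multiset_prod, map_multiset_prod, Multiset.map_map, Multiset.map_map]
  exact congrArg _ (Multiset.map_congr rfl hf)

theorem coassoc :
    (Algebra.TensorProduct.assoc ℝ ℝ ℝ (BCK A) (BCK A) (BCK A)).toAlgHom.comp
      ((Algebra.TensorProduct.map (comulHom (A := A)) (.id ℝ (BCK A))).comp (comulHom (A := A)))
      = (Algebra.TensorProduct.map (.id ℝ (BCK A)) (comulHom (A := A))).comp (comulHom (A := A)) := by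
  apply algHom_ext_graft
  intro a x hx
  have h₁ : ∀ y : BCK A ⊗[ℝ] BCK A,
      Algebra.TensorProduct.assoc ℝ ℝ ℝ (BCK A) (BCK A) (BCK A)
        (Algebra.TensorProduct.map (comulHom (A := A)) (.id ℝ (BCK A)) ((graftLin a).lTensor (BCK A) y)) =
      ((graftLin a).lTensor (BCK A)).lTensor (BCK A)
        (Algebra.TensorProduct.assoc ℝ ℝ ℝ (BCK A) (BCK A) (BCK A)
          (Algebra.TensorProduct.map (comulHom (A := A)) (.id ℝ (BCK A)) y)) := by
    intro y
    induction y using TensorProduct.induction_on with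
    | zero => simp
    | add y z hy hz => simp only [map_add, hy, hz]
    | tmul y z =>
      simp only [LinearMap.lTensor_tmul, Algebra.TensorProduct.map_tmul, AlgHom.id_apply]
      induction comulHom y using TensorProduct.induction_on with
      | zero => simp
      | add u v hu hv => simp only [TensorProduct.add_tmul, map_add, hu, hv]
      | tmul u v => simp
  have h₂ : ∀ y : BCK A ⊗[ℝ] BCK A,
      Algebra.TensorProduct.map (.id ℝ (BCK A)) (comulHom (A := A)) ((graftLin a).lTensor (BCK A) y) =
      Algebra.TensorProduct.assoc ℝ ℝ ℝ (BCK A) (BCK A) (BCK A)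
        ((graftLin a).lTensor (BCK A) y ⊗ₜ[ℝ] 1) +
      ((graftLin a).lTensor (BCK A)).lTensor (BCK A)
        (Algebra.TensorProduct.map (.id ℝ (BCK A)) (comulHom (A := A)) y) := by
    intro y
    induction y using TensorProduct.induction_on with
    | zero => simp
    | add y z hy hz =>
      simp only [map_add, hy, hz, TensorProduct.add_tmul]
      abel
    | tmul y z => simp [comulHom_graftLin, TensorProduct.tmul_add]
  have hx' : Algebra.TensorProduct.assoc ℝ ℝ ℝ (BCK A) (BCK A) (BCK A)
      (Algebra.TensorProduct.map (comulHom (A := A)) (.id ℝ (BCK A)) (comulHom x)) =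
      Algebra.TensorProduct.map (.id ℝ (BCK A)) (comulHom (A := A)) (comulHom x) := hx
  change Algebra.TensorProduct.assoc ℝ ℝ ℝ (BCK A) (BCK A) (BCK A)
      (Algebra.TensorProduct.map (comulHom (A := A)) (.id ℝ (BCK A)) (comulHom (graftLin a x))) =
      Algebra.TensorProduct.map (.id ℝ (BCK A)) (comulHom (A := A)) (comulHom (graftLin a x))
  rw [comulHom_graftLin, map_add, map_add, map_add, h₁, h₂, hx', ← add_assoc]
  congr 1
  simp [comulHom_graftLin, TensorProduct.add_tmul, Algebra.TensorProduct.one_def]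

theorem counit_left :
    (Algebra.TensorProduct.map (counitHom (A := A)) (.id ℝ (BCK A))).comp (comulHom (A := A))
      = ((Algebra.TensorProduct.lid ℝ (BCK A)).symm : BCK A →ₐ[ℝ] ℝ ⊗[ℝ] BCK A) := by
  apply algHom_ext_graft
  intro a x hx
  have h : ∀ y : BCK A ⊗[ℝ] BCK A,
      Algebra.TensorProduct.map (counitHom (A := A)) (.id ℝ (BCK A)) ((graftLin a).lTensor (BCK A) y) =
      (graftLin a).lTensor ℝ (Algebra.TensorProduct.map (counitHom (A := A)) (.id ℝ (BCK A)) y) := by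
    intro y
    induction y using TensorProduct.induction_on with
    | zero => simp
    | add y z hy hz => simp only [map_add, hy, hz]
    | tmul y z => simp
  have hx' : Algebra.TensorProduct.map (counitHom (A := A)) (.id ℝ (BCK A)) (comulHom x) =
      (1 : ℝ) ⊗ₜ[ℝ] x := hx
  change Algebra.TensorProduct.map (counitHom (A := A)) (.id ℝ (BCK A)) (comulHom (graftLin a x)) =
      (1 : ℝ) ⊗ₜ[ℝ] graftLin a x
  rw [comulHom_graftLin, map_add, h, hx']
  simp [counitHom_graftLin]

theorem counit_right :
    (Algebra.TensorProduct.map (.id ℝ (BCK A)) (counitHom (A := A))).comp (comulHom (A := A))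
      = ((Algebra.TensorProduct.rid ℝ ℝ (BCK A)).symm : BCK A →ₐ[ℝ] BCK A ⊗[ℝ] ℝ) := by
  apply algHom_ext_graft
  intro a x _
  have h : ∀ y : BCK A ⊗[ℝ] BCK A,
      Algebra.TensorProduct.map (.id ℝ (BCK A)) (counitHom (A := A)) ((graftLin a).lTensor (BCK A) y) =
      0 := by
    intro y
    induction y using TensorProduct.induction_on with
    | zero => simp
    | add y z hy hz => simp only [map_add, hy, hz, add_zero]
    | tmul y z => simp [counitHom_graftLin]
  change Algebra.TensorProduct.map (.id ℝ (BCK A)) (counitHom (A := A)) (comulHom (graftLin a x)) =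
      graftLin a x ⊗ₜ[ℝ] (1 : ℝ)
  rw [comulHom_graftLin, map_add, h]
  simp

noncomputable instance : Bialgebra ℝ (BCK A) :=
  Bialgebra.ofAlgHom comulHom counitHom coassoc counit_left counit_right

mutual
/-- The element `(S ⊗ id) (Δ τ)` for a planar tree `τ`, where `S` is the antipode. -/
noncomputable def antipodeAux : PlanarTree A → BCK A ⊗[ℝ] BCK A
  | .node a l =>
    (graftLin a).lTensor (BCK A) (antipodeAuxList l) -
      LinearMap.mul' ℝ (BCK A) ((graftLin a).lTensor (BCK A) (antipodeAuxList l)) ⊗ₜ[ℝ] 1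
/-- The element `(S ⊗ id) (Δ (τ₁ ⋯ τₖ))` for a list of planar trees. -/
noncomputable def antipodeAuxList : List (PlanarTree A) → BCK A ⊗[ℝ] BCK A
  | [] => 1
  | t :: l => antipodeAux t * antipodeAuxList l
end

theorem antipodeAuxList_eq (l : List (PlanarTree A)) :
    antipodeAuxList l = (l.map antipodeAux).prod := by
  induction l with
  | nil => simp [antipodeAuxList]
  | cons t l ih => simp [antipodeAuxList, ih]

theorem antipodeAux_eq_of_iso {t u : PlanarTree A} (h : PlanarTree.Iso t u) :
    antipodeAux t = antipodeAux u := by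
  induction h with
  | refl t => rfl
  | symm _ ih => exact ih.symm
  | trans _ _ ih₁ ih₂ => exact ih₁.trans ih₂
  | perm a h => simp only [antipodeAux, antipodeAuxList_eq, (h.map antipodeAux).prod_eq]
  | branch a l h ih => simp only [antipodeAux, antipodeAuxList, ih]

/-- The algebra morphism `(S ⊗ id) ∘ Δ`. -/
noncomputable def antipodeAuxHom : BCK A →ₐ[ℝ] BCK A ⊗[ℝ] BCK A :=
  liftAlg fun τ => Quotient.lift antipodeAux (fun _ _ h => antipodeAux_eq_of_iso h) τ

theorem antipodeAuxHom_graftLin (a : A) (x : BCK A) :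
    antipodeAuxHom (graftLin a x) = (graftLin a).lTensor (BCK A) (antipodeAuxHom x) -
      LinearMap.mul' ℝ (BCK A) ((graftLin a).lTensor (BCK A) (antipodeAuxHom x)) ⊗ₜ[ℝ] 1 := by
  have h : antipodeAuxHom.toLinearMap ∘ₗ graftLin a =
      (graftLin a).lTensor (BCK A) ∘ₗ (antipodeAuxHom (A := A)).toLinearMap -
      (TensorProduct.mk ℝ (BCK A) (BCK A)).flip 1 ∘ₗ LinearMap.mul' ℝ (BCK A) ∘ₗ
        (graftLin a).lTensor (BCK A) ∘ₗ (antipodeAuxHom (A := A)).toLinearMap := by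
    refine forestBasis.ext fun f => ?_
    obtain ⟨l, rfl⟩ := DecTree.exists_map_mk f
    have hl : antipodeAuxHom (forest (l.map DecTree.mk : Multiset (DecTree A))) =
        antipodeAuxList l := by
      rw [antipodeAuxList_eq, forest, map_multiset_prod]
      simp [antipodeAuxHom, Function.comp_def]
      rfl
    simp only [forestBasis_apply, LinearMap.comp_apply, LinearMap.sub_apply, graftLin_forest,
      AlgHom.toLinearMap_apply, hl, DecTree.graft_map_mk, LinearMap.flip_apply,
      TensorProduct.mk_apply]
    rw [antipodeAuxHom, liftAlg_tree]
    exact antipodeAux.eq_1 a l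
  exact LinearMap.congr_fun h x

/-- The antipode, as an algebra morphism. -/
noncomputable def antipodeHom : BCK A →ₐ[ℝ] BCK A :=
  ((Algebra.TensorProduct.rid ℝ ℝ (BCK A) : BCK A ⊗[ℝ] ℝ →ₐ[ℝ] BCK A).comp
    (Algebra.TensorProduct.map (.id ℝ (BCK A)) (counitHom (A := A)))).comp
      (antipodeAuxHom (A := A))

theorem antipodeHom_graftLin (a : A) (x : BCK A) :
    antipodeHom (graftLin a x) =
      -LinearMap.mul' ℝ (BCK A) ((graftLin a).lTensor (BCK A) (antipodeAuxHom x)) := by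
  have h : ∀ y : BCK A ⊗[ℝ] BCK A,
      Algebra.TensorProduct.map (.id ℝ (BCK A)) (counitHom (A := A))
        ((graftLin a).lTensor (BCK A) y) = 0 := by
    intro y
    induction y using TensorProduct.induction_on with
    | zero => simp
    | add y z hy hz => simp only [map_add, hy, hz, add_zero]
    | tmul y z => simp [counitHom_graftLin]
  change Algebra.TensorProduct.rid ℝ ℝ (BCK A)
    (Algebra.TensorProduct.map (.id ℝ (BCK A)) (counitHom (A := A))
      (antipodeAuxHom (graftLin a x))) = _
  rw [antipodeAuxHom_graftLin, map_sub, h]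
  simp

theorem antipodeAuxHom_eq :
    (Algebra.TensorProduct.map (antipodeHom (A := A)) (.id ℝ (BCK A))).comp (comulHom (A := A)) =
      antipodeAuxHom (A := A) := by
  apply algHom_ext_graft
  intro a x hx
  have h : ∀ y : BCK A ⊗[ℝ] BCK A,
      Algebra.TensorProduct.map (antipodeHom (A := A)) (.id ℝ (BCK A))
        ((graftLin a).lTensor (BCK A) y) =
      (graftLin a).lTensor (BCK A)
        (Algebra.TensorProduct.map (antipodeHom (A := A)) (.id ℝ (BCK A)) y) := by
    intro y
    induction y using TensorProduct.induction_on with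
    | zero => simp
    | add y z hy hz => simp only [map_add, hy, hz]
    | tmul y z => simp
  have hx' : Algebra.TensorProduct.map (antipodeHom (A := A)) (.id ℝ (BCK A)) (comulHom x) =
      antipodeAuxHom x := hx
  change Algebra.TensorProduct.map (antipodeHom (A := A)) (.id ℝ (BCK A))
    (comulHom (graftLin a x)) = antipodeAuxHom (graftLin a x)
  rw [comulHom_graftLin, map_add, h, hx', antipodeAuxHom_graftLin, sub_eq_neg_add]
  simp [antipodeHom_graftLin, TensorProduct.neg_tmul]

theorem antipodeHom_convMul_id :
    WithConv.toConv (antipodeHom (A := A)) * WithConv.toConv (AlgHom.id ℝ (BCK A)) = 1 := by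
  rw [AlgHom.convMul_def, AlgHom.convOne_def]
  congr 1
  change (Algebra.TensorProduct.lmul' ℝ).comp
    ((Algebra.TensorProduct.map (antipodeHom (A := A)) (.id ℝ (BCK A))).comp
      (comulHom (A := A))) = (Algebra.ofId ℝ (BCK A)).comp (counitHom (A := A))
  rw [antipodeAuxHom_eq]
  apply algHom_ext_graft
  intro a x _
  have h : LinearMap.mul' ℝ (BCK A) (antipodeAuxHom (graftLin a x)) = 0 := by
    rw [antipodeAuxHom_graftLin, map_sub]
    simp
  have h' : (Algebra.ofId ℝ (BCK A)) (counitHom (graftLin a x)) = 0 := by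
    rw [counitHom_graftLin, map_zero]
  exact h.trans h'.symm

theorem id_convMul_antipodeHom :
    WithConv.toConv (AlgHom.id ℝ (BCK A)) * WithConv.toConv (antipodeHom (A := A)) = 1 := by
  have h₁ : WithConv.toConv ((antipodeHom (A := A)).comp antipodeHom) *
      WithConv.toConv (antipodeHom (A := A)) = 1 := by
    have h := AlgHom.comp_convMul_distrib (antipodeHom (A := A))
      (WithConv.toConv (antipodeHom (A := A))) (WithConv.toConv (AlgHom.id ℝ (BCK A)))
    rw [antipodeHom_convMul_id] at h
    apply WithConv.ofConv_injective
    refine h.symm.trans ?_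
    apply AlgHom.ext
    intro x
    exact (antipodeHom (A := A)).commutes _
  rw [← left_inv_eq_right_inv h₁ antipodeHom_convMul_id, h₁]

noncomputable instance : HopfAlgebra ℝ (BCK A) where
  antipode := (antipodeHom (A := A)).toLinearMap
  mul_antipode_rTensor_comul :=
    congrArg (fun f => f.ofConv.toLinearMap) (antipodeHom_convMul_id (A := A))
  mul_antipode_lTensor_comul :=
    congrArg (fun f => f.ofConv.toLinearMap) (id_convMul_antipodeHom (A := A))

end BCK

/-! ### Branched rough paths -/

/-- The number `|τ|` of nodes of a forest. -/
def forestSize {A : Type} (f : Multiset (DecTree A)) : ℕ := (f.map DecTree.size).sum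

/-- Branched `γ`-rough paths: functions `X` on `[0,1]²` with values in the characters of the
Butcher–Connes–Kreimer Hopf algebra, with `X_tt = ε`, Chen's rule `X_su ⋆ X_ut = X_st` (the product
of `WithConv` is the convolution product) and `|⟨X_st, τ⟩| ≲ |t - s|^{γ|τ|}` for all forests. -/
structure IsBranchedRoughPath {A : Type} (γ : ℝ) (X : I → I → WithConv (BCK A →ₐ[ℝ] ℝ)) :
    Prop where
  diag : ∀ t, X t t = 1
  chen : ∀ s u t, X s u * X u t = X s t
  bound : ∀ f : Multiset (DecTree A), ∃ C : ℝ, ∀ s t : I,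
    |(X s t).ofConv (BCK.forest f)| ≤ C * |(t : ℝ) - s| ^ (γ * forestSize f)

-- Dyadic sewing of almost additive functions, for exponents other than 1.

section Sewing

-- A path of characters `χ` with small increments `χ_s⁻¹ ⋆ χ_t` is built one degree at a time.
-- Suppose that the increments are of size `|t - s|^(γ j)` in all degrees `j ≤ n`. By Chen's rule
-- they are additive on an element of degree `n + 1` up to a pairing with its reduced coproduct,
-- whose terms split the degree into two smaller positive ones; the defect is thus of size `(|u - s|
-- + |t - u|)^(γ (n + 1))`. `exists_sewing` writes such a function as a genuine increment `z_t -
-- z_s` plus an error of size `|t - s|^(γ (n + 1))`. Multiplying `χ_t` by the exponential of an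
-- infinitesimal character of degree `n + 1` leaves the lower degrees alone and adds an increment in
-- degree `n + 1` (`exists_twist`), so the unwanted `z_t - z_s` can be cancelled
-- (`exists_holder_lift`).
--
-- The added term must vanish on products. This costs nothing: on products of elements of lower
-- degree the bound follows from multiplicativity, so only coordinates modulo decomposables
-- (`exists_infChar_coordinates`) have to be sewn.
--
-- Sewing works for every exponent `a ≠ 1`. For `a > 1` the dyadic defects are summed over all finer
-- levels; for `a < 1` they are handed down from coarse to fine levels, half to each child. Both
-- schemes break down at `a = 1`, which is why `γ⁻¹` must not be an integer: then no `γ n` equals 1.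
-- All degrees are treated alike, and the successive lifts stabilize in each degree
-- (`exists_holder_character_path`).
--
-- Claim (1) is a truncation of this path. Membership in the image of `exp_N` needs a logarithm,
-- which is also built degree by degree (`exists_expChar_eq`). Claim (2) is the untruncated path for
-- the Butcher–Connes–Kreimer algebra graded by the number of nodes.

/-- Dyadic additive corrections: a defect `δ` of size `r ^ m` on the dyadic intervals of level `m`
can be distributed over the subintervals, as long as `r ≠ 1 / 2`. -/
theorem exists_dyadic_correction {r C : ℝ} (hr : 0 < r) (hr2 : r ≠ 1 / 2) (hC : 0 ≤ C)
    (δ : ℕ → ℕ → ℝ) (hδ : ∀ m k, |δ m k| ≤ C * r ^ m) :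
    ∃ (e : ℕ → ℕ → ℝ) (K : ℝ), 0 ≤ K ∧ (∀ m k, |e m k| ≤ K * r ^ m) ∧
      ∀ m k, e (m + 1) (2 * k) + e (m + 1) (2 * k + 1) = e m k - δ m k := by
  rcases lt_or_gt_of_ne hr2 with h | h
  -- Case `r < 1/2`: the correction sums the defects over all dyadic descendants of an interval; the
  -- `2 ^ j` descendants at depth `j` contribute at most `C r^m (2r)^j`.
  · let f : ℕ → ℕ → ℕ → ℝ := fun m k j => ∑ i ∈ Finset.range (2 ^ j), δ (m + j) (2 ^ j * k + i)
    have hf : ∀ m k j, |f m k j| ≤ C * r ^ m * (2 * r) ^ j := by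
      intro m k j
      calc |f m k j| ≤ ∑ i ∈ Finset.range (2 ^ j), |δ (m + j) (2 ^ j * k + i)| :=
            Finset.abs_sum_le_sum_abs _ _
        _ ≤ ∑ i ∈ Finset.range (2 ^ j), C * r ^ (m + j) := Finset.sum_le_sum fun i _ => hδ _ _
        _ = C * r ^ m * (2 * r) ^ j := by
            rw [Finset.sum_const, Finset.card_range, nsmul_eq_mul]
            push_cast
            rw [mul_pow, pow_add]
            ring
    have hgeo : HasSum (fun j : ℕ => (2 * r) ^ j) (1 - 2 * r)⁻¹ :=
      hasSum_geometric_of_lt_one (by positivity) (by linarith)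
    have hs : ∀ m k, Summable (f m k) := fun m k =>
      Summable.of_norm_bounded (hgeo.summable.mul_left (C * r ^ m)) (hf m k)
    refine ⟨fun m k => ∑' j, f m k j, C * (1 - 2 * r)⁻¹, ?_, ?_, ?_⟩
    · have : 0 < 1 - 2 * r := by linarith
      positivity
    · intro m k
      have := tsum_of_norm_bounded (f := f m k) (hgeo.mul_left (C * r ^ m)) (hf m k)
      rw [Real.norm_eq_abs] at this
      linarith
    · intro m k
      have h0 : f m k 0 = δ m k := by simp [f]
      have h1 : ∀ j, f m k (j + 1) = f (m + 1) (2 * k) j + f (m + 1) (2 * k + 1) j := by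
        intro j
        simp only [f]
        rw [pow_succ, mul_two, Finset.sum_range_add]
        congr 1 <;> refine Finset.sum_congr rfl fun i _ => ?_ <;> congr 1 <;> ring
      change ∑' j, f (m + 1) (2 * k) j + ∑' j, f (m + 1) (2 * k + 1) j = ∑' j, f m k j - δ m k
      rw [(hs m k).tsum_eq_zero_add, h0, ← (hs _ _).tsum_add (hs _ _)]
      simp only [h1]
      ring
  -- Case `r > 1/2`: start with `0` and give each child half of `e - δ`. The constant `K = C / (2r -
  -- 1)` solves `K r = (K + C) / 2`, so the bound reproduces itself.
  · let e : ℕ → ℕ → ℝ := fun m => Nat.rec (fun _ => 0)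
      (fun m em i => (em (i / 2) - δ m (i / 2)) / 2) m
    have he : ∀ m i, e (m + 1) i = (e m (i / 2) - δ m (i / 2)) / 2 := fun m i => rfl
    have h2 : 0 < 2 * r - 1 := by linarith
    refine ⟨e, C / (2 * r - 1), by positivity, ?_, ?_⟩
    · intro m
      induction m with
      | zero => intro k; change |(0 : ℝ)| ≤ _; rw [abs_zero]; positivity
      | succ m ih =>
        intro k
        rw [he, abs_div, abs_two]
        have h3 := abs_sub (e m (k / 2)) (δ m (k / 2))
        have h4 : C / (2 * r - 1) * r ^ (m + 1) =
            (C / (2 * r - 1) * r ^ m + C * r ^ m) / 2 := by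
          field_simp
          ring
        rw [h4]
        have := ih (k / 2)
        have := hδ m (k / 2)
        linarith
    · intro m k
      rw [he, he, show 2 * k / 2 = k by omega, show (2 * k + 1) / 2 = k by omega]
      ring

/-- Almost additive functions of two variables on the half line are locally close to increments. -/
theorem exists_sewing_halfLine {a : ℝ} (ha : 0 < a) (ha1 : a ≠ 1) {C : ℝ} (c : ℝ → ℝ → ℝ)
    (hc : ∀ s u t, |c s u + c u t - c s t| ≤ C * (|u - s| + |t - u|) ^ a) :
    ∃ (z : ℝ → ℝ) (K : ℝ), ∀ s t, 0 ≤ s → s ≤ t → t ≤ s + 1 →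
      |c s t - (z t - z s)| ≤ K * (t - s) ^ a := by
  have hC : 0 ≤ C := by
    have := (abs_nonneg _).trans (hc 0 1 1)
    simpa using this
  set r : ℝ := (2⁻¹ : ℝ) ^ a with hr
  have hr0 : 0 < r := by positivity
  have hr1 : r < 1 := Real.rpow_lt_one (by norm_num) (by norm_num) ha
  have hr2 : r ≠ 1 / 2 := by
    intro h
    apply ha1
    have := congrArg Real.log h
    rw [hr, Real.log_rpow (by norm_num), one_div] at this
    have h2 : Real.log (2⁻¹ : ℝ) ≠ 0 := (Real.log_neg (by norm_num) (by norm_num)).ne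
    exact mul_right_cancel₀ h2 (by linarith)
  have hrm : ∀ m : ℕ, ((2⁻¹ : ℝ) ^ m) ^ a = r ^ m := by
    intro m
    rw [← Real.rpow_natCast, ← Real.rpow_mul (by norm_num), mul_comm, Real.rpow_mul (by norm_num),
      Real.rpow_natCast]
  -- bound of the defect for points at distance comparable to the mesh
  have hcm : ∀ (m : ℕ) (s u t : ℝ), |u - s| + |t - u| ≤ 4 * (2⁻¹ : ℝ) ^ m →
      |c s u + c u t - c s t| ≤ C * 4 ^ a * r ^ m := by
    intro m s u t h
    refine (hc s u t).trans ?_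
    rw [mul_assoc, ← hrm, ← Real.mul_rpow (by norm_num) (by positivity)]
    gcongr
  set C' : ℝ := C * 4 ^ a with hC'
  have hC'0 : 0 ≤ C' := by positivity
  let p : ℕ → ℕ → ℝ := fun m k => k * (2⁻¹ : ℝ) ^ m
  have hp0 : ∀ m k, p (m + 1) (2 * k) = p m k := by
    intro m k; simp only [p]; push_cast; rw [pow_succ]; ring
  have hp1 : ∀ m k, p m (k + 1) = p m k + (2⁻¹ : ℝ) ^ m := by
    intro m k; simp only [p]; push_cast; ring
  have hpow : ∀ m : ℕ, (2⁻¹ : ℝ) ^ (m + 1) = (2⁻¹ : ℝ) ^ m / 2 := by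
    intro m; rw [pow_succ]; ring
  have hpos : ∀ m : ℕ, 0 < (2⁻¹ : ℝ) ^ m := fun m => by positivity
  obtain ⟨e, K, hK, heK, he⟩ := exists_dyadic_correction hr0 hr2 hC'0
    (fun m k => c (p m k) (p (m + 1) (2 * k + 1)) + c (p (m + 1) (2 * k + 1)) (p m (k + 1))
      - c (p m k) (p m (k + 1))) (by
      intro m k
      apply hcm
      rw [hp1 (m + 1), hp0, hp1 m, hpow]
      have := hpos m
      rw [abs_of_nonneg (by linarith), abs_of_nonneg (by linarith)]
      linarith)
  -- With the corrections `e`, the sums of `c` over mesh intervals no longer depend on the level: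
  -- the corrections of two children absorb the defect of their parent.
  let Z : ℕ → ℕ → ℝ := fun m k => ∑ i ∈ Finset.range k, (c (p m i) (p m (i + 1)) + e m i)
  have hZ1 : ∀ m k, Z m (k + 1) = Z m k + (c (p m k) (p m (k + 1)) + e m k) := fun m k =>
    Finset.sum_range_succ _ _
  have hZ2 : ∀ m k, Z (m + 1) (2 * k) = Z m k := by
    intro m k
    induction k with
    | zero => simp [Z]
    | succ k ih =>
      rw [hZ1, ← ih, show 2 * (k + 1) = 2 * k + 1 + 1 by ring, hZ1, hZ1]
      have := he m k
      rw [show 2 * k + 1 + 1 = 2 * (k + 1) by ring, hp0, hp0]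
      linarith
  let fl : ℕ → ℝ → ℕ := fun m t => ⌊t * 2 ^ m⌋₊
  have hinv : ∀ m : ℕ, (2 : ℝ) ^ m * (2⁻¹ : ℝ) ^ m = 1 := by
    intro m; rw [← mul_pow]; norm_num
  have hfl0 : ∀ m t, 0 ≤ t → p m (fl m t) ≤ t := by
    intro m t ht
    have := Nat.floor_le (show 0 ≤ t * 2 ^ m by positivity)
    calc p m (fl m t) ≤ t * 2 ^ m * (2⁻¹ : ℝ) ^ m := by
          simp only [p, fl]; gcongr
      _ = t := by rw [mul_assoc, hinv, mul_one]
  have hfl1 : ∀ m t, t < p m (fl m t) + (2⁻¹ : ℝ) ^ m := by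
    intro m t
    have := Nat.lt_floor_add_one (t * 2 ^ m)
    calc t = t * 2 ^ m * (2⁻¹ : ℝ) ^ m := by rw [mul_assoc, hinv, mul_one]
      _ < (fl m t + 1) * (2⁻¹ : ℝ) ^ m := by
          apply mul_lt_mul_of_pos_right _ (hpos m); exact this
      _ = _ := by simp only [p]; ring
  have hflmono : ∀ m k l, p m k < p m l + (2⁻¹ : ℝ) ^ m → k ≤ l := by
    intro m k l h
    rw [← hp1] at h
    have h2 := lt_of_mul_lt_mul_right h (hpos m).le
    exact Nat.lt_succ_iff.mp (by exact_mod_cast h2)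
  -- Level `m` approximation of `z t`: the corrected sum up to the last mesh point below `t`,
  -- completed by `c` on the remaining piece.
  let w : ℕ → ℝ → ℝ := fun m t => Z m (fl m t) + c (p m (fl m t)) t
  have hw : ∀ m t, 0 ≤ t → |w m t - w (m + 1) t| ≤ (K + C') * r ^ m := by
    intro m t ht
    have h1 := hfl0 m t ht
    have h2 := hfl1 m t
    have h3 := hfl0 (m + 1) t ht
    have h4 := hfl1 (m + 1) t
    have hm := hpos m
    -- Refining the mesh either keeps the last mesh point below `t` or moves it to the next
    -- midpoint; only the second case changes `w`, by one defect and one correction.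
    have h5 : 2 * fl m t ≤ fl (m + 1) t := by
      apply hflmono (m + 1); rw [hp0]; linarith
    have h6 : fl (m + 1) t ≤ 2 * fl m t + 1 := by
      apply hflmono (m + 1); rw [hp1 (m + 1), hp0, hpow]; linarith
    rcases Nat.le_or_eq_of_le_succ h6 with h7 | h7
    · have h8 : fl (m + 1) t = 2 * fl m t := le_antisymm h7 h5
      simp only [w, h8, hZ2, hp0, sub_self, abs_zero]
      positivity
    · rw [Nat.succ_eq_add_one] at h7
      simp only [w, h7, hZ1, hZ2, hp0]
      rw [h7, hp1 (m + 1), hp0] at h3 h4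
      rw [hpow] at h3 h4
      have h8 := hcm m (p m (fl m t)) (p (m + 1) (2 * fl m t + 1)) t (by
        rw [hp1 (m + 1), hp0, hpow, abs_of_nonneg (by linarith), abs_of_nonneg (by linarith)]
        linarith)
      have h9 := heK (m + 1) (2 * fl m t)
      have h10 : K * r ^ (m + 1) ≤ K * r ^ m := by
        gcongr 1
        exact pow_le_pow_of_le_one hr0.le hr1.le (Nat.le_succ m)
      rw [abs_le] at h8 h9 ⊢
      constructor <;> linarith [h8.1, h8.2, h9.1, h9.2]
  have hlim : ∀ t, ∃ z, 0 ≤ t → ∀ m, |w m t - z| ≤ (K + C') / (1 - r) * r ^ m := by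
    intro t
    by_cases ht : 0 ≤ t
    · have hd : ∀ m, dist (w m t) (w (m + 1) t) ≤ (K + C') * r ^ m := fun m => hw m t ht
      obtain ⟨z, hz⟩ := cauchySeq_tendsto_of_complete
        (cauchySeq_of_le_geometric r (K + C') hr1 hd)
      refine ⟨z, fun _ m => ?_⟩
      have := dist_le_of_le_geometric_of_tendsto r (K + C') hr1 hd hz m
      rw [Real.dist_eq] at this
      refine this.trans (le_of_eq ?_)
      ring
    -- The value at negative times is irrelevant.
    · exact ⟨0, fun h => absurd h ht⟩
  choose z hz using hlim
  refine ⟨z, (2 * ((K + C') / (1 - r)) + K + 3 * C') / r, fun s t hs hst hts => ?_⟩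
  rcases hst.eq_or_lt with rfl | hlt
  · have h1 := hc s s s
    rw [sub_self, abs_zero, add_zero, Real.zero_rpow ha.ne', mul_zero] at h1
    have h2 : c s s = 0 := by
      have := abs_nonpos_iff.mp h1; linarith
    simp [h2, Real.zero_rpow ha.ne']
  -- The level with `2^-(m+1) < t - s ≤ 2^-m`: the mesh points below `s` and `t` coincide or are
  -- neighbours. Passing from `r^m` to `r^(m+1)`, which is at most `(t - s)^a`, costs the factor `1
  -- / r`.
  obtain ⟨m, hm1, hm2⟩ := exists_nat_pow_near_of_lt_one (x := t - s) (y := (2⁻¹ : ℝ))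
    (by linarith) (by linarith) (by norm_num) (by norm_num)
  have hb : r ^ (m + 1) ≤ (t - s) ^ a := by
    rw [← hrm]; gcongr
  have key : |c s t - (z t - z s)| ≤ (2 * ((K + C') / (1 - r)) + K + 3 * C') * r ^ m := by
    have hzs := hz s hs m
    have hzt := hz t (hs.trans hst) m
    have h1 := hfl0 m s hs
    have h2 := hfl1 m s
    have h3 := hfl0 m t (hs.trans hst)
    have h4 := hfl1 m t
    have h0 := hpos m
    have h5 : fl m s ≤ fl m t := by apply hflmono m; linarith
    have h6 : fl m t ≤ fl m s + 1 := by apply hflmono m; rw [hp1 m]; linarith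
    have h7 := hcm m (p m (fl m s)) s t (by
      rw [abs_of_nonneg (by linarith), abs_of_nonneg (by linarith)]; linarith)
    have hww : |w m t - w m s - c s t| ≤ (K + 2 * C') * r ^ m := by
      rcases Nat.le_or_eq_of_le_succ h6 with h8 | h8
      · have h9 : fl m t = fl m s := le_antisymm h8 h5
        simp only [w, h9]
        have : 0 ≤ K * r ^ m := by positivity
        have : 0 ≤ C' * r ^ m := by positivity
        rw [abs_le] at h7 ⊢
        constructor <;> linarith [h7.1, h7.2]
      · rw [Nat.succ_eq_add_one] at h8
        simp only [w, h8, hZ1]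
        rw [h8, hp1] at h3 h4
        have h9 := hcm m (p m (fl m s)) (p m (fl m s + 1)) t (by
          rw [hp1, abs_of_nonneg (by linarith), abs_of_nonneg (by linarith)]; linarith)
        have h10 := heK m (fl m s)
        rw [abs_le] at h7 h9 h10 ⊢
        constructor <;> linarith [h7.1, h7.2, h9.1, h9.2, h10.1, h10.2]
    have : 0 ≤ C' * r ^ m := by positivity
    rw [abs_le] at hww hzs hzt ⊢
    constructor <;> linarith [hww.1, hww.2, hzs.1, hzs.2, hzt.1, hzt.2]
  refine key.trans ?_
  have : 0 < 1 - r := by linarith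
  calc _ = (2 * ((K + C') / (1 - r)) + K + 3 * C') / r * r ^ (m + 1) := by
        rw [pow_succ]; field_simp
    _ ≤ _ := by gcongr

/-- Almost additive functions on `[0,1]²`, with exponent `a ≠ 1`, are close to increments:
for `a > 1` this is the sewing lemma. -/
theorem exists_sewing {a : ℝ} (ha : 0 < a) (ha1 : a ≠ 1) {C : ℝ} (c : I → I → ℝ)
    (hc : ∀ s u t : I, |c s u + c u t - c s t| ≤ C * (|(u : ℝ) - s| + |(t : ℝ) - u|) ^ a) :
    ∃ (z : I → ℝ) (K : ℝ), ∀ s t : I, |c s t - (z t - z s)| ≤ K * |(t : ℝ) - s| ^ a := by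
  have hC : 0 ≤ C := by
    have := (abs_nonneg _).trans (hc 0 1 1)
    simpa using this
  -- Clamping to `[0,1]` does not increase distances, so the almost additivity extends to the line.
  let pr : ℝ → I := Set.projIcc 0 1 zero_le_one
  have hpr : ∀ s t, |(pr t : ℝ) - pr s| ≤ |t - s| := fun s t =>
    Set.abs_projIcc_sub_projIcc zero_le_one
  obtain ⟨z, K, hz⟩ := exists_sewing_halfLine ha ha1 (C := C) (fun s t => c (pr s) (pr t)) (by
    intro s u t
    refine (hc _ _ _).trans ?_
    exact mul_le_mul_of_nonneg_left
      (Real.rpow_le_rpow (by positivity) (add_le_add (hpr _ _) (hpr _ _)) ha.le) hC)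
  have hpI : ∀ t : I, pr t = t := fun t => Set.projIcc_val _ t
  have h0 : ∀ s, c s s = 0 := by
    intro s
    have h1 := hc s s s
    rw [sub_self, abs_zero, add_zero, Real.zero_rpow ha.ne', mul_zero] at h1
    have := abs_nonpos_iff.mp h1
    linarith
  have hle : ∀ s t : I, s ≤ t → |c s t - (z t - z s)| ≤ K * |(t : ℝ) - s| ^ a := by
    intro s t hst
    have hst' : (s : ℝ) ≤ t := hst
    have := hz s t s.2.1 hst' (by linarith [t.2.2, s.2.1])
    simp only [hpI] at this
    rwa [abs_of_nonneg (show (0 : ℝ) ≤ t - s by linarith)]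
  refine ⟨fun t => z t, K + C * 2 ^ a, fun s t => ?_⟩
  rcases le_total s t with hst | hst
  · refine (hle s t hst).trans ?_
    gcongr
    have : 0 ≤ C * 2 ^ a := by positivity
    linarith
  -- For reversed times, almost additivity along `s, t, s` together with `c s s = 0` compares `c s
  -- t` with `-c t s`.
  · have h1 := hle t s hst
    have h2 := hc s t s
    rw [h0, sub_zero, abs_sub_comm (s : ℝ) t, ← two_mul,
      Real.mul_rpow (by norm_num) (abs_nonneg _), ← mul_assoc] at h2
    rw [abs_sub_comm (s : ℝ) t] at h1
    rw [add_mul]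
    rw [abs_le] at h1 h2 ⊢
    constructor <;> linarith [h1.1, h1.2, h2.1, h2.2]

end Sewing

-- Reduced coproduct, counit and antipode in a connected grading.

section GradedHopf

variable {H : Type*} [Ring H] [HopfAlgebra ℝ H]

/-- The functional `f ⊗ g` on `H ⊗ H`. -/
noncomputable def tensorPair (f g : H →ₗ[ℝ] ℝ) : H ⊗[ℝ] H →ₗ[ℝ] ℝ :=
  LinearMap.mul' ℝ ℝ ∘ₗ TensorProduct.map f g

@[simp] theorem tensorPair_tmul (f g : H →ₗ[ℝ] ℝ) (a b : H) :
    tensorPair f g (a ⊗ₜ[ℝ] b) = f a * g b := rfl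

theorem starProd_apply (f g : H →ₗ[ℝ] ℝ) (x : H) :
    starProd f g x = tensorPair f g (Coalgebra.comul (R := ℝ) x) := rfl

theorem starProd_counit_left (f : H →ₗ[ℝ] ℝ) : starProd Coalgebra.counit f = f :=
  congrArg WithConv.ofConv (one_mul (WithConv.toConv f))

theorem starPow_zero (f : H →ₗ[ℝ] ℝ) : starPow f 0 = Coalgebra.counit :=
  congrArg WithConv.ofConv (pow_zero (WithConv.toConv f))

theorem starPow_succ (f : H →ₗ[ℝ] ℝ) (k : ℕ) : starPow f (k + 1) = starProd f (starPow f k) :=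
  congrArg WithConv.ofConv (pow_succ' (WithConv.toConv f) k)

/-- The reduced coproduct `Δ x - x ⊗ 1 - 1 ⊗ x`. -/
noncomputable def reducedComul : H →ₗ[ℝ] H ⊗[ℝ] H :=
  Coalgebra.comul - (TensorProduct.mk ℝ H H).flip 1 - TensorProduct.mk ℝ H H 1

theorem comul_eq_reducedComul (x : H) :
    Coalgebra.comul (R := ℝ) x = x ⊗ₜ[ℝ] 1 + 1 ⊗ₜ[ℝ] x + reducedComul x := by
  simp only [reducedComul, LinearMap.sub_apply, LinearMap.flip_apply, TensorProduct.mk_apply]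
  abel

theorem starProd_eq (f g : H →ₗ[ℝ] ℝ) (x : H) :
    starProd f g x = f x * g 1 + f 1 * g x + tensorPair f g (reducedComul x) := by
  rw [starProd_apply, comul_eq_reducedComul, map_add, map_add, tensorPair_tmul, tensorPair_tmul]

/-- The elements of total degree `n` in the tensor square of the augmentation ideal. -/
def posTensors (𝒜 : ℕ → Submodule ℝ H) (n : ℕ) : Submodule ℝ (H ⊗[ℝ] H) :=
  Submodule.span ℝ {t | ∃ p q : ℕ, 0 < p ∧ 0 < q ∧ p + q = n ∧
    ∃ a ∈ 𝒜 p, ∃ b ∈ 𝒜 q, a ⊗ₜ[ℝ] b = t}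

theorem posTensors_induction {𝒜 : ℕ → Submodule ℝ H} {n : ℕ} {P : H ⊗[ℝ] H → Prop}
    (h0 : P 0) (hadd : ∀ s t, P s → P t → P (s + t)) (hsmul : ∀ (c : ℝ) s, P s → P (c • s))
    (h : ∀ p q a b, 0 < p → 0 < q → p + q = n → a ∈ 𝒜 p → b ∈ 𝒜 q → P (a ⊗ₜ[ℝ] b))
    {t : H ⊗[ℝ] H} (ht : t ∈ posTensors 𝒜 n) : P t := by
  refine Submodule.span_induction (p := fun t _ => P t) ?_ h0 (fun s t _ _ => hadd s t)
    (fun c s _ => hsmul c s) ht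
  rintro _ ⟨p, q, hp, hq, hpq, a, ha, b, hb, rfl⟩
  exact h p q a b hp hq hpq ha hb

/-- Both factors of a tensor of positive bidegree and total degree `n` have degree `< n`; this
drives all the inductions on the degree. -/
theorem tensorPair_congr {𝒜 : ℕ → Submodule ℝ H} {n : ℕ} {f f' g g' : H →ₗ[ℝ] ℝ}
    (hf : ∀ p, p < n → ∀ a ∈ 𝒜 p, f a = f' a) (hg : ∀ p, p < n → ∀ a ∈ 𝒜 p, g a = g' a)
    {t : H ⊗[ℝ] H} (ht : t ∈ posTensors 𝒜 n) : tensorPair f g t = tensorPair f' g' t := by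
  refine posTensors_induction (P := fun t => tensorPair f g t = tensorPair f' g' t)
    (by simp) (fun s t hs ht => by simp only [map_add, hs, ht])
    (fun c s hs => by simp only [map_smul, hs]) ?_ ht
  intro p q a b hp hq hpq ha hb
  rw [tensorPair_tmul, tensorPair_tmul, hf p (by omega) a ha, hg q (by omega) b hb]

theorem tensorPair_eq_zero_left {𝒜 : ℕ → Submodule ℝ H} {n : ℕ} {f : H →ₗ[ℝ] ℝ}
    (hf : ∀ p, 0 < p → p < n → ∀ a ∈ 𝒜 p, f a = 0) (g : H →ₗ[ℝ] ℝ)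
    {t : H ⊗[ℝ] H} (ht : t ∈ posTensors 𝒜 n) : tensorPair f g t = 0 := by
  refine posTensors_induction (P := fun t => tensorPair f g t = 0)
    (by simp) (fun s t hs ht => by simp only [map_add, hs, ht, add_zero])
    (fun c s hs => by simp only [map_smul, hs, smul_zero]) ?_ ht
  intro p q a b hp hq hpq ha hb
  rw [tensorPair_tmul, hf p hp (by omega) a ha, zero_mul]

theorem tensorPair_eq_zero_right {𝒜 : ℕ → Submodule ℝ H} {n : ℕ} {g : H →ₗ[ℝ] ℝ}
    (f : H →ₗ[ℝ] ℝ) (hg : ∀ q, 0 < q → q < n → ∀ a ∈ 𝒜 q, g a = 0)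
    {t : H ⊗[ℝ] H} (ht : t ∈ posTensors 𝒜 n) : tensorPair f g t = 0 := by
  refine posTensors_induction (P := fun t => tensorPair f g t = 0)
    (by simp) (fun s t hs ht => by simp only [map_add, hs, ht, add_zero])
    (fun c s hs => by simp only [map_smul, hs, smul_zero]) ?_ ht
  intro p q a b hp hq hpq ha hb
  rw [tensorPair_tmul, hg q hq (by omega) b hb, mul_zero]

variable (𝒜 : ℕ → Submodule ℝ H) [GradedAlgebra 𝒜]

theorem linearMap_ext_homogeneous {M : Type*} [AddCommGroup M] [Module ℝ M] {f g : H →ₗ[ℝ] M}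
    (h : ∀ n, ∀ x ∈ 𝒜 n, f x = g x) : f = g := by
  ext x
  induction x using DirectSum.Decomposition.inductionOn 𝒜 with
  | zero => simp
  | homogeneous x => exact h _ x x.2
  | add x y hx hy => rw [map_add, map_add, hx, hy]

theorem bilin_ext_homogeneous {M : Type*} [AddCommGroup M] [Module ℝ M] {f g : H →ₗ[ℝ] H →ₗ[ℝ] M}
    (h : ∀ m n, ∀ x ∈ 𝒜 m, ∀ y ∈ 𝒜 n, f x y = g x y) : f = g :=
  linearMap_ext_homogeneous 𝒜 fun m x hx => linearMap_ext_homogeneous 𝒜 fun n y hy =>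
    h m n x hx y hy

theorem eq_zero_of_mem_of_mem {m n : ℕ} (hmn : m ≠ n) {x : H} (hm : x ∈ 𝒜 m) (hn : x ∈ 𝒜 n) :
    x = 0 := by
  by_contra hx
  exact hmn (DirectSum.degree_eq_of_mem_mem 𝒜 hm hn hx)

theorem gradedProj_apply {N n : ℕ} {x : H} (hx : x ∈ 𝒜 n) :
    gradedProj 𝒜 N x = if n ≤ N then x else 0 := by
  rw [gradedProj, LinearMap.sum_apply]
  have h : ∀ k, GradedAlgebra.proj 𝒜 k x = if k = n then x else 0 := by
    intro k
    rw [GradedAlgebra.proj_apply]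
    split_ifs with hk
    · subst hk; exact DirectSum.decompose_of_mem_same 𝒜 hx
    · exact DirectSum.decompose_of_mem_ne 𝒜 hx (Ne.symm hk)
  simp only [h, Finset.sum_ite_eq', Finset.mem_range, Nat.lt_succ_iff]

theorem dualTrunc_apply_of_le {N n : ℕ} (f : H →ₗ[ℝ] ℝ) (hn : n ≤ N) {x : H} (hx : x ∈ 𝒜 n) :
    dualTrunc 𝒜 N f x = f x := by
  rw [dualTrunc, LinearMap.comp_apply, gradedProj_apply 𝒜 hx, if_pos hn]

theorem dualTrunc_apply_of_lt {N n : ℕ} (f : H →ₗ[ℝ] ℝ) (hn : N < n) {x : H} (hx : x ∈ 𝒜 n) :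
    dualTrunc 𝒜 N f x = 0 := by
  rw [dualTrunc, LinearMap.comp_apply, gradedProj_apply 𝒜 hx, if_neg (by omega), map_zero]

theorem dualTrunc_congr {N : ℕ} {f g : H →ₗ[ℝ] ℝ} (h : ∀ n ≤ N, ∀ x ∈ 𝒜 n, f x = g x) :
    dualTrunc 𝒜 N f = dualTrunc 𝒜 N g := by
  refine linearMap_ext_homogeneous 𝒜 fun n x hx => ?_
  rcases le_or_gt n N with hn | hn
  · rw [dualTrunc_apply_of_le 𝒜 _ hn hx, dualTrunc_apply_of_le 𝒜 _ hn hx, h n hn x hx]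
  · rw [dualTrunc_apply_of_lt 𝒜 _ hn hx, dualTrunc_apply_of_lt 𝒜 _ hn hx]

/-- A functional of a single positive degree that vanishes on decomposable elements is an
infinitesimal character. -/
theorem isInfChar_of_degree {m : ℕ} {f : H →ₗ[ℝ] ℝ}
    (hc : 𝒜 0 = Submodule.span ℝ {(1 : H)})
    (hε : ∀ n, 0 < n → ∀ x ∈ 𝒜 n, Coalgebra.counit (R := ℝ) x = 0)
    (hm : 0 < m) (h0 : ∀ n, n ≠ m → ∀ x ∈ 𝒜 n, f x = 0)
    (hf : ∀ i j, 0 < i → 0 < j → i + j = m → ∀ x ∈ 𝒜 i, ∀ y ∈ 𝒜 j, f (x * y) = 0) :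
    IsInfChar f := by
  have h1 : f 1 = 0 := h0 0 hm.ne 1 SetLike.GradedOne.one_mem
  have key : (LinearMap.mul ℝ H).compr₂ f =
      (LinearMap.mul ℝ ℝ).compl₁₂ f (Coalgebra.counit (R := ℝ)) +
        (LinearMap.mul ℝ ℝ).compl₁₂ (Coalgebra.counit (R := ℝ)) f := by
    refine bilin_ext_homogeneous 𝒜 fun i j x hx y hy => ?_
    simp only [LinearMap.compr₂_apply, LinearMap.mul_apply', LinearMap.add_apply,
      LinearMap.compl₁₂_apply]
    rcases Nat.eq_zero_or_pos i with rfl | hi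
    · rw [hc, Submodule.mem_span_singleton] at hx
      obtain ⟨c, rfl⟩ := hx
      simp [h1]
    rcases Nat.eq_zero_or_pos j with rfl | hj
    · rw [hc, Submodule.mem_span_singleton] at hy
      obtain ⟨c, rfl⟩ := hy
      simp [h1, mul_comm]
    rw [hε i hi x hx, hε j hj y hy, mul_zero, zero_mul, add_zero]
    by_cases hij : i + j = m
    · exact hf i j hi hj hij x hx y hy
    · exact h0 _ hij _ (SetLike.GradedMul.mul_mem hx hy)
  intro x y
  exact LinearMap.congr_fun (LinearMap.congr_fun key x) y

variable [IsLocallyFiniteConnectedHopf 𝒜]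

theorem mem_zero_iff {x : H} : x ∈ 𝒜 0 ↔ ∃ c : ℝ, c • (1 : H) = x := by
  rw [IsLocallyFiniteConnectedHopf.connected (𝒜 := 𝒜), Submodule.mem_span_singleton]

/-- Since degree zero is spanned by `1`, the parts of bidegree `(n, 0)` and `(0, n)` have a factor
`1`. That `y = z = x` for `n > 0` comes out only later, from the counit laws. -/
theorem comul_mem_sup (n : ℕ) {x : H} (hx : x ∈ 𝒜 n) :
    ∃ y ∈ 𝒜 n, ∃ z ∈ 𝒜 n, ∃ r ∈ posTensors 𝒜 n,
      Coalgebra.comul (R := ℝ) x = y ⊗ₜ[ℝ] 1 + 1 ⊗ₜ[ℝ] z + r := by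
  have key : (⨆ (p : ℕ) (q : ℕ) (_ : p + q = n),
      LinearMap.range (TensorProduct.map (𝒜 p).subtype (𝒜 q).subtype)) ≤
      (𝒜 n).map ((TensorProduct.mk ℝ H H).flip 1) ⊔ (𝒜 n).map (TensorProduct.mk ℝ H H 1) ⊔
        posTensors 𝒜 n := by
    refine iSup_le fun p => iSup_le fun q => iSup_le fun hpq => ?_
    rintro _ ⟨t, rfl⟩
    induction t using TensorProduct.induction_on with
    | zero => simp
    | add s t hs ht => rw [map_add]; exact Submodule.add_mem _ hs ht
    | tmul a b =>
      rw [TensorProduct.map_tmul, Submodule.subtype_apply, Submodule.subtype_apply]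
      rcases Nat.eq_zero_or_pos p with rfl | hp
      · obtain ⟨c, hc⟩ := (mem_zero_iff 𝒜).mp a.2
        refine Submodule.mem_sup_left (Submodule.mem_sup_right ⟨c • (b : H), ?_, ?_⟩)
        · rw [zero_add] at hpq; subst hpq; exact Submodule.smul_mem _ _ b.2
        · rw [← hc, TensorProduct.mk_apply, TensorProduct.smul_tmul]
      rcases Nat.eq_zero_or_pos q with rfl | hq
      · obtain ⟨c, hc⟩ := (mem_zero_iff 𝒜).mp b.2
        refine Submodule.mem_sup_left (Submodule.mem_sup_left ⟨c • (a : H), ?_, ?_⟩)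
        · rw [add_zero] at hpq; subst hpq; exact Submodule.smul_mem _ _ a.2
        · rw [← hc, LinearMap.flip_apply, TensorProduct.mk_apply, TensorProduct.smul_tmul]
      · exact Submodule.mem_sup_right (Submodule.subset_span
          ⟨p, q, hp, hq, hpq, a, a.2, b, b.2, rfl⟩)
  obtain ⟨u, hu, r, hr, h⟩ := Submodule.mem_sup.mp
    (key (IsLocallyFiniteConnectedHopf.comul_mem (𝒜 := 𝒜) n x hx))
  obtain ⟨_, ⟨y, hy, rfl⟩, _, ⟨z, hz, rfl⟩, rfl⟩ := Submodule.mem_sup.mp hu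
  exact ⟨y, hy, z, hz, r, hr, h.symm⟩

/-- By induction the counit kills the remainder `r` on either side, so the counit laws give `ε(y) 1
+ z = x = y + ε(z) 1`. Then `ε(y) 1` and `ε(z) 1` lie in degree `0` and in degree `n` at once, hence
vanish. -/
theorem counit_eq_zero_and_reducedComul_mem (n : ℕ) (hn : 0 < n) : ∀ x ∈ 𝒜 n,
    Coalgebra.counit (R := ℝ) x = 0 ∧ reducedComul x ∈ posTensors 𝒜 n := by
  induction n using Nat.strong_induction_on with
  | _ n ih =>
    intro x hx
    obtain ⟨y, hy, z, hz, r, hr, h⟩ := comul_mem_sup 𝒜 n hx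
    have hl : TensorProduct.lid ℝ H ((Coalgebra.counit (R := ℝ)).rTensor H r) = 0 := by
      refine posTensors_induction (P := fun r => TensorProduct.lid ℝ H
        ((Coalgebra.counit (R := ℝ)).rTensor H r) = 0) (by simp)
        (fun s t hs ht => by simp only [map_add, hs, ht, add_zero])
        (fun c s hs => by simp only [map_smul, hs, smul_zero]) ?_ hr
      intro p q a b hp hq hpq ha hb
      simp [(ih p (by omega) hp a ha).1]
    have hr' : TensorProduct.rid ℝ H ((Coalgebra.counit (R := ℝ)).lTensor H r) = 0 := by
      refine posTensors_induction (P := fun r => TensorProduct.rid ℝ H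
        ((Coalgebra.counit (R := ℝ)).lTensor H r) = 0) (by simp)
        (fun s t hs ht => by simp only [map_add, hs, ht, add_zero])
        (fun c s hs => by simp only [map_smul, hs, smul_zero]) ?_ hr
      intro p q a b hp hq hpq ha hb
      simp [(ih q (by omega) hq b hb).1]
    have h1 : Coalgebra.counit (R := ℝ) y • (1 : H) + z = x := by
      have := congrArg (TensorProduct.lid ℝ H) (Coalgebra.rTensor_counit_comul (R := ℝ) x)
      rw [h, map_add, map_add, hl] at this
      simpa using this
    have h2 : y + Coalgebra.counit (R := ℝ) z • (1 : H) = x := by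
      have := congrArg (TensorProduct.rid ℝ H) (Coalgebra.lTensor_counit_comul (R := ℝ) x)
      rw [h, map_add, map_add, hr'] at this
      simpa using this
    have h3 : Coalgebra.counit (R := ℝ) y • (1 : H) = 0 :=
      eq_zero_of_mem_of_mem 𝒜 hn.ne ((mem_zero_iff 𝒜).mpr ⟨_, rfl⟩)
        (by rw [eq_sub_of_add_eq h1]; exact Submodule.sub_mem _ hx hz)
    have h4 : Coalgebra.counit (R := ℝ) z • (1 : H) = 0 :=
      eq_zero_of_mem_of_mem 𝒜 hn.ne ((mem_zero_iff 𝒜).mpr ⟨_, rfl⟩)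
        (by rw [eq_sub_of_add_eq' h2]; exact Submodule.sub_mem _ hx hy)
    rw [h3, zero_add] at h1
    rw [h4, add_zero] at h2
    subst h1
    subst h2
    constructor
    · simpa using congrArg (Coalgebra.counit (R := ℝ)) h3
    · have : reducedComul y = r := by
        rw [comul_eq_reducedComul] at h
        exact add_left_cancel h
      rwa [this]

theorem counit_eq_zero {n : ℕ} (hn : 0 < n) {x : H} (hx : x ∈ 𝒜 n) :
    Coalgebra.counit (R := ℝ) x = 0 :=
  (counit_eq_zero_and_reducedComul_mem 𝒜 n hn x hx).1

theorem reducedComul_mem {n : ℕ} (hn : 0 < n) {x : H} (hx : x ∈ 𝒜 n) :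
    reducedComul x ∈ posTensors 𝒜 n :=
  (counit_eq_zero_and_reducedComul_mem 𝒜 n hn x hx).2

/-- The antipode identity reads `S x = -(x + ∑ S(x') x'')` over the reduced coproduct, whose left
factors have smaller degree. -/
theorem antipode_mem (n : ℕ) : ∀ x ∈ 𝒜 n, HopfAlgebra.antipode ℝ x ∈ 𝒜 n := by
  induction n using Nat.strong_induction_on with
  | _ n ih =>
    intro x hx
    rcases Nat.eq_zero_or_pos n with rfl | hn
    · obtain ⟨c, rfl⟩ := (mem_zero_iff 𝒜).mp hx
      rw [map_smul, HopfAlgebra.antipode_one]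
      exact hx
    have h := HopfAlgebra.mul_antipode_rTensor_comul_apply (R := ℝ) x
    rw [comul_eq_reducedComul, counit_eq_zero 𝒜 hn hx, map_zero, map_add, map_add, map_add,
      map_add, LinearMap.rTensor_tmul, LinearMap.rTensor_tmul, LinearMap.mul'_apply,
      LinearMap.mul'_apply, HopfAlgebra.antipode_one, mul_one, one_mul, add_assoc] at h
    rw [eq_neg_of_add_eq_zero_left h]
    refine Submodule.neg_mem _ (Submodule.add_mem _ hx ?_)
    refine posTensors_induction (P := fun r => LinearMap.mul' ℝ H
        ((HopfAlgebra.antipode ℝ).rTensor H r) ∈ 𝒜 n) (by simp)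
        (fun s t hs ht => by simp only [map_add]; exact Submodule.add_mem _ hs ht)
        (fun c s hs => by simp only [map_smul]; exact Submodule.smul_mem _ _ hs) ?_
        (reducedComul_mem 𝒜 hn hx)
    intro p q a b hp hq hpq ha hb
    rw [LinearMap.rTensor_tmul, LinearMap.mul'_apply, ← hpq]
    exact SetLike.GradedMul.mul_mem (ih p (by omega) a ha) hb

/-- The convolution of two functionals in degree `n` depends on their values in degrees `≤ n`. -/
theorem starProd_congr {n : ℕ} {f f' g g' : H →ₗ[ℝ] ℝ}
    (hf : ∀ p ≤ n, ∀ a ∈ 𝒜 p, f a = f' a) (hg : ∀ p ≤ n, ∀ a ∈ 𝒜 p, g a = g' a)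
    {x : H} (hx : x ∈ 𝒜 n) : starProd f g x = starProd f' g' x := by
  have h1 : (1 : H) ∈ 𝒜 0 := SetLike.GradedOne.one_mem
  rcases Nat.eq_zero_or_pos n with rfl | hn
  · obtain ⟨c, rfl⟩ := (mem_zero_iff 𝒜).mp hx
    rw [map_smul, map_smul, starProd_apply, starProd_apply, Bialgebra.comul_one,
      Algebra.TensorProduct.one_def, tensorPair_tmul, tensorPair_tmul, hf 0 le_rfl 1 h1,
      hg 0 le_rfl 1 h1]
  · rw [starProd_eq, starProd_eq, hf 0 hn.le 1 h1, hg 0 hn.le 1 h1, hf n le_rfl x hx,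
      hg n le_rfl x hx, tensorPair_congr (fun p hp => hf p hp.le) (fun p hp => hg p hp.le)
        (reducedComul_mem 𝒜 hn hx)]

theorem starProd_one_apply (f g : H →ₗ[ℝ] ℝ) : starProd f g 1 = f 1 * g 1 := by
  rw [starProd_apply, Bialgebra.comul_one, Algebra.TensorProduct.one_def, tensorPair_tmul]

end GradedHopf

-- Invertibility of characters, exponentials and logarithms.

section Characters

variable {H : Type*} [Ring H] [HopfAlgebra ℝ H]

/-- The monoid of characters of `H`, under convolution. -/
abbrev Character (H : Type*) [Ring H] [HopfAlgebra ℝ H] : Type _ := WithConv (H →ₐ[ℝ] ℝ)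

namespace Character

/-- A character, as a linear functional. -/
noncomputable def lin (χ : Character H) : H →ₗ[ℝ] ℝ := χ.ofConv.toLinearMap

@[simp] theorem lin_apply (χ : Character H) (x : H) : χ.lin x = χ.ofConv x := rfl

theorem lin_injective : Function.Injective (lin : Character H → _) := fun _ _ h =>
  WithConv.ofConv_injective (AlgHom.toLinearMap_injective h)

@[simp] theorem lin_one : (1 : Character H).lin = Coalgebra.counit := rfl

theorem lin_mul (χ ψ : Character H) : (χ * ψ).lin = starProd χ.lin ψ.lin := rfl

theorem mul_apply (χ ψ : Character H) (x : H) :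
    (χ * ψ).lin x = χ.lin x + ψ.lin x + tensorPair χ.lin ψ.lin (reducedComul x) := by
  rw [lin_mul, starProd_eq]
  simp

/-- The composition of a character with the antipode. -/
noncomputable def antipodeComp (χ : Character H) : Character H :=
  WithConv.toConv <| AlgHom.ofLinearMap (χ.lin ∘ₗ HopfAlgebra.antipode ℝ) (by simp)
    -- The antipode reverses products, which is harmless because the values lie in the commutative
    -- ring `ℝ`.
    (fun x y => by
      simp [HopfAlgebra.antipode_mul_antidistrib, mul_comm])

theorem mul_antipodeComp (χ : Character H) : χ * χ.antipodeComp = 1 := by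
  apply lin_injective
  have h := LinearMap.algHom_comp_convMul_distrib χ.ofConv
    (WithConv.toConv LinearMap.id) (WithConv.toConv (HopfAlgebra.antipode ℝ (A := H)))
  rw [LinearMap.id_mul_antipode] at h
  refine h.symm.trans ?_
  ext x
  simp

theorem antipodeComp_mul (χ : Character H) : χ.antipodeComp * χ = 1 := by
  apply lin_injective
  have h := LinearMap.algHom_comp_convMul_distrib χ.ofConv
    (WithConv.toConv (HopfAlgebra.antipode ℝ (A := H))) (WithConv.toConv LinearMap.id)
  rw [LinearMap.antipode_mul_id] at h
  refine h.symm.trans ?_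
  ext x
  simp

/-- A character, as a unit of the monoid of characters. -/
noncomputable def toUnit (χ : Character H) : (Character H)ˣ :=
  ⟨χ, χ.antipodeComp, χ.mul_antipodeComp, χ.antipodeComp_mul⟩

@[simp] theorem val_toUnit (χ : Character H) : (χ.toUnit : Character H) = χ := rfl

theorem lin_inv (χ : (Character H)ˣ) :
    (↑χ⁻¹ : Character H).lin = dualInv (χ : Character H).lin := by
  have : χ = (χ : Character H).toUnit := Units.ext rfl
  conv_lhs => rw [this]
  rfl

variable (𝒜 : ℕ → Submodule ℝ H) [GradedAlgebra 𝒜] [IsLocallyFiniteConnectedHopf 𝒜]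

theorem mul_congr {n : ℕ} {χ χ' ψ ψ' : Character H}
    (hχ : ∀ p ≤ n, ∀ a ∈ 𝒜 p, χ.lin a = χ'.lin a)
    (hψ : ∀ p ≤ n, ∀ a ∈ 𝒜 p, ψ.lin a = ψ'.lin a) :
    ∀ p ≤ n, ∀ a ∈ 𝒜 p, (χ * ψ).lin a = (χ' * ψ').lin a := fun _ hp _ ha =>
  starProd_congr 𝒜 (fun q hq => hχ q (hq.trans hp)) (fun q hq => hψ q (hq.trans hp)) ha

theorem inv_congr {n : ℕ} {χ ψ : (Character H)ˣ}
    (h : ∀ p ≤ n, ∀ a ∈ 𝒜 p, (χ : Character H).lin a = (ψ : Character H).lin a) :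
    ∀ p ≤ n, ∀ a ∈ 𝒜 p, (↑χ⁻¹ : Character H).lin a = (↑ψ⁻¹ : Character H).lin a := by
  intro p hp a ha
  rw [lin_inv, lin_inv]
  exact h p hp _ (antipode_mem 𝒜 p a ha)

end Character

/-! ### The exponential of an infinitesimal character -/

theorem IsInfChar.map_one {α : H →ₗ[ℝ] ℝ} (hα : IsInfChar α) : α 1 = 0 := by
  have := hα 1 1
  simpa using this

theorem starPow_succ_one {α : H →ₗ[ℝ] ℝ} (hα : α 1 = 0) (k : ℕ) : starPow α (k + 1) 1 = 0 := by
  rw [starPow_succ, starProd_one_apply, hα, zero_mul]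

/-- Each of the `k` factors `α` vanishes at `1` and so uses up at least one degree. Hence the
exponential series is a finite sum in each degree. -/
theorem starPow_eq_zero (𝒜 : ℕ → Submodule ℝ H) [GradedAlgebra 𝒜] [IsLocallyFiniteConnectedHopf 𝒜]
    {α : H →ₗ[ℝ] ℝ} (hα : α 1 = 0) (k : ℕ) :
    ∀ n < k, ∀ x ∈ 𝒜 n, starPow α k x = 0 := by
  induction k with
  | zero => intro n hn; omega
  | succ k ih =>
    intro n hn x hx
    rcases Nat.eq_zero_or_pos n with rfl | hn0
    · obtain ⟨c, rfl⟩ := (mem_zero_iff 𝒜).mp hx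
      rw [map_smul, starPow_succ_one hα, smul_zero]
    · obtain ⟨k, rfl⟩ : ∃ l, k = l + 1 := ⟨k - 1, by omega⟩
      rw [starPow_succ, starProd_eq, starPow_succ_one hα, hα, mul_zero, zero_mul, zero_add,
        zero_add, tensorPair_eq_zero_right α (fun q _ hq => ih q (by omega))
        (reducedComul_mem 𝒜 hn0 hx)]

/-- Leibniz rule for the convolution with an infinitesimal character. -/
theorem IsInfChar.starProd_mul {α : H →ₗ[ℝ] ℝ} (hα : IsInfChar α) {ι : Type*} (s : Finset ι)
    {g : H →ₗ[ℝ] ℝ} {g₁ g₂ : ι → H →ₗ[ℝ] ℝ} (hg : ∀ x y, g (x * y) = ∑ j ∈ s, g₁ j x * g₂ j y)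
    (x y : H) : starProd α g (x * y) =
      ∑ j ∈ s, (starProd α (g₁ j) x * g₂ j y + g₁ j x * starProd α (g₂ j) y) := by
  have key : ∀ u v : H ⊗[ℝ] H, tensorPair α g (u * v) =
      ∑ j ∈ s, (tensorPair α (g₁ j) u * tensorPair Coalgebra.counit (g₂ j) v +
        tensorPair Coalgebra.counit (g₁ j) u * tensorPair α (g₂ j) v) := by
    intro u v
    induction u using TensorProduct.induction_on with
    | zero => simp
    | add u u' hu hu' =>
      rw [add_mul, map_add, hu, hu', ← Finset.sum_add_distrib]
      refine Finset.sum_congr rfl fun j _ => ?_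
      rw [map_add, map_add]
      ring
    | tmul a b =>
      induction v using TensorProduct.induction_on with
      | zero => simp
      | add v v' hv hv' =>
        rw [mul_add, map_add, hv, hv', ← Finset.sum_add_distrib]
        refine Finset.sum_congr rfl fun j _ => ?_
        rw [map_add, map_add]
        ring
      | tmul c d =>
        rw [Algebra.TensorProduct.tmul_mul_tmul, tensorPair_tmul, hα, hg, Finset.mul_sum]
        refine Finset.sum_congr rfl fun j _ => ?_
        simp only [tensorPair_tmul]
        ring
  rw [starProd_apply, Bialgebra.comul_mul, key]
  refine Finset.sum_congr rfl fun j _ => ?_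
  simp only [← starProd_apply, starProd_counit_left]

/-- The divided convolution power `α^{⋆ k} / k!`. -/
noncomputable def divPow (α : H →ₗ[ℝ] ℝ) (k : ℕ) : H →ₗ[ℝ] ℝ :=
  ((k.factorial : ℝ)⁻¹) • starPow α k

theorem starProd_divPow (α : H →ₗ[ℝ] ℝ) (k : ℕ) (x : H) :
    starProd α (divPow α k) x = (k + 1) * divPow α (k + 1) x := by
  have h : starProd α (divPow α k) = ((k.factorial : ℝ)⁻¹) • starPow α (k + 1) := by
    rw [starPow_succ, divPow]
    ext x
    rw [starProd_apply, LinearMap.smul_apply, starProd_apply, tensorPair, tensorPair,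
      TensorProduct.map_smul_right, LinearMap.comp_smul, LinearMap.smul_apply]
  rw [h, divPow, LinearMap.smul_apply, LinearMap.smul_apply, Nat.factorial_succ, smul_eq_mul,
    smul_eq_mul]
  have : ((k : ℝ) + 1) ≠ 0 := by positivity
  push_cast
  field_simp

/-- This binomial formula makes the exponential multiplicative, by the Cauchy product. In the
induction the two Leibniz sums carry the weights `p.1` and `p.2`, which add up to `k + 1`. -/
theorem IsInfChar.divPow_mul {α : H →ₗ[ℝ] ℝ} (hα : IsInfChar α) (k : ℕ) (x y : H) :
    divPow α k (x * y) =
      ∑ p ∈ Finset.HasAntidiagonal.antidiagonal k, divPow α p.1 x * divPow α p.2 y := by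
  induction k generalizing x y with
  | zero => simp [divPow, starPow_zero]
  | succ k ih =>
    have h : ((k : ℝ) + 1) ≠ 0 := by positivity
    apply mul_left_cancel₀ h
    rw [← starProd_divPow, hα.starProd_mul (Finset.HasAntidiagonal.antidiagonal k)
      (g₁ := fun p => divPow α p.1) (g₂ := fun p => divPow α p.2) ih]
    simp only [starProd_divPow]
    have h1 := Finset.Nat.sum_antidiagonal_succ (n := k)
      (f := fun p => (p.1 : ℝ) * (divPow α p.1 x * divPow α p.2 y))
    have h2 := Finset.Nat.sum_antidiagonal_succ' (n := k)
      (f := fun p => (p.2 : ℝ) * (divPow α p.1 x * divPow α p.2 y))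
    push_cast at h1 h2
    rw [zero_mul, zero_add] at h1
    rw [zero_mul, zero_add] at h2
    have h3 : ((k : ℝ) + 1) *
        ∑ p ∈ Finset.HasAntidiagonal.antidiagonal (k + 1), divPow α p.1 x * divPow α p.2 y =
        ∑ p ∈ Finset.HasAntidiagonal.antidiagonal (k + 1),
          (p.1 : ℝ) * (divPow α p.1 x * divPow α p.2 y) +
        ∑ p ∈ Finset.HasAntidiagonal.antidiagonal (k + 1),
          (p.2 : ℝ) * (divPow α p.1 x * divPow α p.2 y) := by
      rw [← Finset.sum_add_distrib, Finset.mul_sum]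
      refine Finset.sum_congr rfl fun p hp => ?_
      have : (p.1 : ℝ) + p.2 = k + 1 := by
        exact_mod_cast Finset.HasAntidiagonal.mem_antidiagonal.mp hp
      rw [← add_mul, this]
    rw [h3, h1, h2, ← Finset.sum_add_distrib]
    refine Finset.sum_congr rfl fun p _ => ?_
    ring

theorem divPow_eq_zero (𝒜 : ℕ → Submodule ℝ H) [GradedAlgebra 𝒜]
    [IsLocallyFiniteConnectedHopf 𝒜] {α : H →ₗ[ℝ] ℝ} (hα : α 1 = 0) {n k : ℕ} (h : n < k) {x : H}
    (hx : x ∈ 𝒜 n) : divPow α k x = 0 := by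
  rw [divPow, LinearMap.smul_apply, starPow_eq_zero 𝒜 hα k n h x hx, smul_zero]

theorem finite_support_divPow (𝒜 : ℕ → Submodule ℝ H) [GradedAlgebra 𝒜]
    [IsLocallyFiniteConnectedHopf 𝒜] {α : H →ₗ[ℝ] ℝ} (hα : α 1 = 0)
    (x : H) :
    (Function.support fun k => divPow α k x).Finite := by
  induction x using DirectSum.Decomposition.inductionOn 𝒜 with
  | zero => simp
  | @homogeneous n x =>
    refine (Set.finite_le_nat n).subset fun k hk => ?_
    by_contra hkn
    exact hk (divPow_eq_zero 𝒜 hα (not_le.mp hkn) x.2)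
  | add x y hx hy =>
    refine (hx.union hy).subset fun k hk => ?_
    by_contra h
    simp only [Set.mem_union, Function.mem_support, not_or, not_not] at h
    exact hk (by simp only [map_add, h.1, h.2, add_zero])

variable (𝒜 : ℕ → Submodule ℝ H) [GradedAlgebra 𝒜] [IsLocallyFiniteConnectedHopf 𝒜]

/-- The exponential of an infinitesimal character, as a character. -/
noncomputable def expChar {α : H →ₗ[ℝ] ℝ} (hα : IsInfChar α) : Character H :=
  WithConv.toConv <| AlgHom.ofLinearMap
    { toFun := fun x => ∑' k, divPow α k x
      map_add' := fun x y => by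
        have hs : ∀ x, Summable fun k => divPow α k x := fun x =>
          summable_of_hasFiniteSupport (finite_support_divPow 𝒜 hα.map_one x)
        simp only [map_add]
        exact (hs x).tsum_add (hs y)
      map_smul' := fun c x => by
        simp only [map_smul, smul_eq_mul, RingHom.id_apply]
        exact tsum_mul_left }
    (by
      change ∑' k, divPow α k 1 = 1
      rw [tsum_eq_single 0]
      · simp [divPow, starPow_zero]
      · intro k hk
        exact divPow_eq_zero 𝒜 hα.map_one (Nat.pos_of_ne_zero hk) SetLike.GradedOne.one_mem)
    (fun x y => by
      have hs : ∀ x, Summable fun k => ‖divPow α k x‖ := fun x =>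
        summable_of_hasFiniteSupport ((finite_support_divPow 𝒜 hα.map_one x).subset
          fun k hk => by simpa using hk)
      change ∑' k, divPow α k (x * y) = (∑' k, divPow α k x) * ∑' k, divPow α k y
      rw [tsum_mul_tsum_eq_tsum_sum_antidiagonal_of_summable_norm (hs x) (hs y)]
      exact tsum_congr fun k => hα.divPow_mul k x y)

theorem expChar_apply {α : H →ₗ[ℝ] ℝ} (hα : IsInfChar α) {n N : ℕ} (hn : n ≤ N) {x : H}
    (hx : x ∈ 𝒜 n) : (expChar 𝒜 hα).lin x = ∑ k ∈ Finset.range (N + 1), divPow α k x := by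
  change ∑' k, divPow α k x = _
  refine tsum_eq_sum fun k hk => divPow_eq_zero 𝒜 hα.map_one ?_ hx
  rw [Finset.mem_range] at hk
  omega

theorem truncExp_eq {α : H →ₗ[ℝ] ℝ} (hα : IsInfChar α) (N : ℕ) :
    truncExp 𝒜 N α = dualTrunc 𝒜 N (expChar 𝒜 hα).lin := by
  refine dualTrunc_congr 𝒜 fun n hn x hx => ?_
  rw [expChar_apply 𝒜 hα hn hx, LinearMap.sum_apply]
  rfl

/-- Adding a functional of degree `n + 1` changes the convolution powers in degrees `≤ n + 1`
only through the first power. -/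
theorem starPow_add_apply {α β : H →ₗ[ℝ] ℝ} (hα : α 1 = 0) {n : ℕ}
    (hβ : ∀ p ≤ n, ∀ x ∈ 𝒜 p, β x = 0) (k : ℕ) :
    (∀ p ≤ n, ∀ x ∈ 𝒜 p, starPow (α + β) k x = starPow α k x) ∧
      ∀ x ∈ 𝒜 (n + 1), starPow (α + β) k x = starPow α k x + if k = 1 then β x else 0 := by
  have h1 : β 1 = 0 := hβ 0 (Nat.zero_le n) 1 SetLike.GradedOne.one_mem
  have hαβ : ∀ p ≤ n, ∀ x ∈ 𝒜 p, (α + β) x = α x := fun p hp x hx => by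
    rw [LinearMap.add_apply, hβ p hp x hx, add_zero]
  induction k with
  | zero => simp [starPow_zero]
  | succ k ih =>
    constructor
    · intro p hp x hx
      rw [starPow_succ, starPow_succ]
      exact starProd_congr 𝒜 (fun q hq => hαβ q (hq.trans hp))
        (fun q hq => ih.1 q (hq.trans hp)) hx
    · intro x hx
      rw [starPow_succ, starPow_succ, starProd_eq, starProd_eq,
        tensorPair_congr (fun p hp => hαβ p (by omega)) (fun p hp => ih.1 p (by omega))
          (reducedComul_mem 𝒜 (Nat.succ_pos n) hx)]
      have h0 : (α + β) 1 = 0 := by rw [LinearMap.add_apply, hα, h1, add_zero]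
      rw [h0, hα]
      rcases k with - | k
      · simp [starPow_zero]
        ring
      · rw [starPow_succ_one h0, starPow_succ_one hα]
        simp

theorem divPow_add_apply {α β : H →ₗ[ℝ] ℝ} (hα : α 1 = 0) {n : ℕ}
    (hβ : ∀ p ≤ n, ∀ x ∈ 𝒜 p, β x = 0) (k : ℕ) {p : ℕ} (hp : p ≤ n + 1) {x : H} (hx : x ∈ 𝒜 p) :
    divPow (α + β) k x = divPow α k x + if k = 1 then β x else 0 := by
  have h := starPow_add_apply 𝒜 hα hβ k
  rw [divPow, divPow, LinearMap.smul_apply, LinearMap.smul_apply]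
  rcases Nat.le_or_eq_of_le_succ hp with hp | rfl
  · rw [h.1 p hp x hx, hβ p hp x hx, ite_self, add_zero]
  · rw [h.2 x hx]
    split_ifs with hk
    · subst hk; simp
    · simp

theorem expChar_add_apply {α β : H →ₗ[ℝ] ℝ} (hα : IsInfChar α) (hαβ : IsInfChar (α + β)) {n : ℕ}
    (hβ : ∀ p ≤ n, ∀ x ∈ 𝒜 p, β x = 0) {p : ℕ} (hp : p ≤ n + 1) {x : H} (hx : x ∈ 𝒜 p) :
    (expChar 𝒜 hαβ).lin x = (expChar 𝒜 hα).lin x + β x := by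
  rw [expChar_apply 𝒜 hαβ hp hx, expChar_apply 𝒜 hα hp hx]
  simp only [divPow_add_apply 𝒜 hα.map_one hβ _ hp hx, Finset.sum_add_distrib]
  congr 1
  rw [Finset.sum_ite_eq', if_pos (by simp)]

theorem isInfChar_zero : IsInfChar (0 : H →ₗ[ℝ] ℝ) := fun x y => by simp

theorem IsInfChar.add {α β : H →ₗ[ℝ] ℝ} (hα : IsInfChar α) (hβ : IsInfChar β) :
    IsInfChar (α + β) := fun x y => by
  simp only [LinearMap.add_apply, hα x y, hβ x y]
  ring

theorem expChar_zero : (expChar 𝒜 isInfChar_zero : Character H) = 1 := by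
  apply Character.lin_injective
  refine linearMap_ext_homogeneous 𝒜 fun n x hx => ?_
  rw [expChar_apply 𝒜 isInfChar_zero le_rfl hx, Finset.sum_eq_single 0]
  · simp [divPow, starPow_zero]
  · intro k _ hk
    obtain ⟨k, rfl⟩ := Nat.exists_eq_succ_of_ne_zero hk
    have : starPow (0 : H →ₗ[ℝ] ℝ) (k + 1) = 0 := by
      rw [starPow_succ]
      exact congrArg WithConv.ofConv (zero_mul _)
    rw [divPow, Nat.succ_eq_add_one, this, smul_zero, LinearMap.zero_apply]
  · simp

/-- The exponential of an infinitesimal character of degree `n + 1`, up to degree `n + 1`. -/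
theorem expChar_apply_of_degree {β : H →ₗ[ℝ] ℝ} (hβi : IsInfChar β) {n : ℕ}
    (hβ : ∀ p ≤ n, ∀ x ∈ 𝒜 p, β x = 0) {p : ℕ} (hp : p ≤ n + 1) {x : H} (hx : x ∈ 𝒜 p) :
    (expChar 𝒜 hβi).lin x = Coalgebra.counit (R := ℝ) x + β x := by
  have h0 : IsInfChar (0 + β) := by rwa [zero_add]
  have := expChar_add_apply 𝒜 isInfChar_zero h0 hβ hp hx
  rw [expChar_zero, Character.lin_one] at this
  rw [← this]
  simp only [zero_add]

/-- Every character agrees, up to a given degree, with the exponential of an infinitesimal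
character of bounded degree. -/
theorem exists_expChar_eq (χ : Character H) (n : ℕ) :
    ∃ (α : H →ₗ[ℝ] ℝ) (hα : IsInfChar α), (∀ m, n < m → ∀ x ∈ 𝒜 m, α x = 0) ∧
      ∀ p ≤ n, ∀ x ∈ 𝒜 p, χ.lin x = (expChar 𝒜 hα).lin x := by
  induction n with
  | zero =>
    refine ⟨0, isInfChar_zero, by simp, fun p hp x hx => ?_⟩
    obtain rfl : p = 0 := by omega
    obtain ⟨c, rfl⟩ := (mem_zero_iff 𝒜).mp hx
    simp
  | succ n ih =>
    obtain ⟨α, hα, hα', h⟩ := ih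
    -- What is left of `χ` after dividing by the exponential found so far. It is trivial in degrees
    -- `1, …, n`, so its part of degree `n + 1` kills products and is the next term of the
    -- logarithm.
    set ω : Character H := ↑(expChar 𝒜 hα).toUnit⁻¹ * χ with hω
    have hωχ : expChar 𝒜 hα * ω = χ := by
      rw [hω, ← mul_assoc]
      exact (congrArg (· * χ) (expChar 𝒜 hα).toUnit.mul_inv).trans (one_mul χ)
    have hω1 : ∀ p ≤ n, ∀ x ∈ 𝒜 p, ω.lin x = Coalgebra.counit (R := ℝ) x := by
      intro p hp x hx
      rw [hω, Character.mul_congr 𝒜 (n := n) (χ' := ↑(expChar 𝒜 hα).toUnit⁻¹)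
        (ψ' := (expChar 𝒜 hα).toUnit) (fun _ _ _ _ => rfl) h p hp x hx, Units.inv_mul,
        Character.lin_one]
    have hω0 : ∀ p, 0 < p → p < n + 1 → ∀ x ∈ 𝒜 p, ω.lin x = 0 := fun p hp hpn x hx => by
      rw [hω1 p (by omega) x hx, counit_eq_zero 𝒜 hp hx]
    set β : H →ₗ[ℝ] ℝ := ω.lin ∘ₗ GradedAlgebra.proj 𝒜 (n + 1) with hβ
    have hβ1 : ∀ x ∈ 𝒜 (n + 1), β x = ω.lin x := fun x hx => by
      rw [hβ, LinearMap.comp_apply, GradedAlgebra.proj_apply,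
        DirectSum.decompose_of_mem_same 𝒜 hx]
    have hβ0 : ∀ p, p ≠ n + 1 → ∀ x ∈ 𝒜 p, β x = 0 := fun p hp x hx => by
      rw [hβ, LinearMap.comp_apply, GradedAlgebra.proj_apply,
        DirectSum.decompose_of_mem_ne 𝒜 hx hp, map_zero]
    have hβi : IsInfChar β := by
      refine isInfChar_of_degree 𝒜 IsLocallyFiniteConnectedHopf.connected
        (fun m hm x hx => counit_eq_zero 𝒜 hm hx) (Nat.succ_pos n) hβ0 ?_
      intro i j hi hj hij x hx y hy
      rw [hβ1 _ (by rw [← Nat.succ_eq_add_one, ← hij]; exact SetLike.GradedMul.mul_mem hx hy),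
        Character.lin_apply, map_mul, ← Character.lin_apply, hω0 i hi (by omega) x hx, zero_mul]
    refine ⟨α + β, hα.add hβi, fun m hm x hx => ?_, fun p hp x hx => ?_⟩
    · rw [LinearMap.add_apply, hα' m (by omega) x hx, hβ0 m (by omega) x hx, add_zero]
    · rw [expChar_add_apply 𝒜 hα (hα.add hβi) (fun q hq => hβ0 q (by omega)) hp hx]
      rcases Nat.le_or_eq_of_le_succ hp with hp | rfl
      · rw [h p hp x hx, hβ0 p (by omega) x hx, add_zero]
      · rw [hβ1 x hx, ← hωχ, Character.mul_apply, tensorPair_eq_zero_right _ hω0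
          (reducedComul_mem 𝒜 (Nat.succ_pos n) hx), add_zero]

theorem dualTrunc_mem_truncGroup (χ : Character H) (N : ℕ) :
    dualTrunc 𝒜 N χ.lin ∈ truncGroup 𝒜 N := by
  obtain ⟨α, hα, hα', h⟩ := exists_expChar_eq 𝒜 χ N
  exact ⟨α, ⟨hα, hα'⟩, by rw [truncExp_eq 𝒜 hα, dualTrunc_congr 𝒜 h]⟩

end Characters

-- Paths of characters and their Hölder lift, degree by degree.

section Paths

variable {H : Type*} [Ring H] [HopfAlgebra ℝ H]

/-- The increments `χ_s⁻¹ ⋆ χ_t` of a path of characters, as linear functionals. -/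
noncomputable def increment (χ : I → (Character H)ˣ) (s t : I) : H →ₗ[ℝ] ℝ :=
  Character.lin ((↑(χ s)⁻¹ : Character H) * χ t)

theorem increment_mul (χ : I → (Character H)ˣ) (s t : I) (x y : H) :
    increment χ s t (x * y) = increment χ s t x * increment χ s t y :=
  map_mul ((↑(χ s)⁻¹ : Character H) * χ t).ofConv x y

/-- Chen's rule with the terms `x ⊗ 1` and `1 ⊗ x` split off: the failure of additivity only
involves the reduced coproduct, hence lower degrees. -/
theorem increment_chen (χ : I → (Character H)ˣ) (s u t : I) (x : H) :
    increment χ s t x = increment χ s u x + increment χ u t x +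
      tensorPair (increment χ s u) (increment χ u t) (reducedComul x) := by
  have h : (↑(χ s)⁻¹ : Character H) * χ t =
      ((↑(χ s)⁻¹ : Character H) * χ u) * ((↑(χ u)⁻¹ : Character H) * χ t) := by
    rw [mul_assoc, ← mul_assoc (χ u : Character H), Units.mul_inv, one_mul]
  rw [increment, h, Character.mul_apply]
  rfl

/-- The elements on which a family of functionals indexed by `[0,1]²` is bounded by a multiple of
`|t - s| ^ e`. -/
def holderSubmodule (F : I → I → H →ₗ[ℝ] ℝ) (e : ℝ) : Submodule ℝ H where
  carrier := {x | ∃ C : ℝ, ∀ s t : I, |F s t x| ≤ C * |(t : ℝ) - s| ^ e}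
  zero_mem' := ⟨0, fun s t => by simp⟩
  add_mem' := by
    rintro x y ⟨C, hC⟩ ⟨C', hC'⟩
    refine ⟨C + C', fun s t => ?_⟩
    rw [map_add, add_mul]
    exact (abs_add_le _ _).trans (add_le_add (hC s t) (hC' s t))
  smul_mem' := by
    rintro c x ⟨C, hC⟩
    refine ⟨|c| * C, fun s t => ?_⟩
    rw [map_smul, smul_eq_mul, abs_mul, mul_assoc]
    exact mul_le_mul_of_nonneg_left (hC s t) (abs_nonneg c)

theorem mul_rpow_le_of_le {a b e f C D A B M : ℝ} (ha : 0 ≤ a) (hb : 0 ≤ b) (haM : a ≤ M)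
    (hbM : b ≤ M) (he : 0 ≤ e) (hf : 0 ≤ f) (hA : |A| ≤ C * a ^ e) (hB : |B| ≤ D * b ^ f) :
    |A * B| ≤ |C| * |D| * M ^ (e + f) := by
  have hM : 0 ≤ M := ha.trans haM
  rw [abs_mul, Real.rpow_add_of_nonneg hM he hf]
  calc |A| * |B| ≤ (|C| * M ^ e) * (|D| * M ^ f) := by
        refine mul_le_mul (hA.trans ?_) (hB.trans ?_) (abs_nonneg _) (by positivity)
        · exact mul_le_mul (le_abs_self C) (Real.rpow_le_rpow ha haM he) (by positivity)
            (abs_nonneg C)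
        · exact mul_le_mul (le_abs_self D) (Real.rpow_le_rpow hb hbM hf) (by positivity)
            (abs_nonneg D)
    _ = _ := by ring

/-- The factors have degrees `p + q = n`, so their bounds multiply to the exponent `γ p + γ q = γ
n`. Applied to the reduced coproduct, this is the almost additivity required for sewing. -/
theorem tensorPair_bound {𝒜 : ℕ → Submodule ℝ H} {γ : ℝ} (hγ : 0 < γ) {F : I → I → H →ₗ[ℝ] ℝ}
    {n : ℕ} (hF : ∀ j < n, ∀ x ∈ 𝒜 j, x ∈ holderSubmodule F (γ * j)) {r : H ⊗[ℝ] H}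
    (hr : r ∈ posTensors 𝒜 n) : ∃ C : ℝ, ∀ s u t : I,
      |tensorPair (F s u) (F u t) r| ≤ C * (|(u : ℝ) - s| + |(t : ℝ) - u|) ^ (γ * n) := by
  refine posTensors_induction (P := fun r => ∃ C : ℝ, ∀ s u t : I,
      |tensorPair (F s u) (F u t) r| ≤ C * (|(u : ℝ) - s| + |(t : ℝ) - u|) ^ (γ * n))
    ⟨0, by simp⟩ ?_ ?_ ?_ hr
  · rintro r r' ⟨C, hC⟩ ⟨C', hC'⟩
    refine ⟨C + C', fun s u t => ?_⟩
    rw [map_add, add_mul]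
    exact (abs_add_le _ _).trans (add_le_add (hC s u t) (hC' s u t))
  · rintro c r ⟨C, hC⟩
    refine ⟨|c| * C, fun s u t => ?_⟩
    rw [map_smul, smul_eq_mul, abs_mul, mul_assoc]
    exact mul_le_mul_of_nonneg_left (hC s u t) (abs_nonneg c)
  · intro p q a b hp hq hpq ha hb
    obtain ⟨C, hC⟩ := hF p (by omega) a ha
    obtain ⟨D, hD⟩ := hF q (by omega) b hb
    refine ⟨|C| * |D|, fun s u t => ?_⟩
    rw [tensorPair_tmul, ← hpq, Nat.cast_add, mul_add]
    exact mul_rpow_le_of_le (abs_nonneg _) (abs_nonneg _)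
      (le_add_of_nonneg_right (abs_nonneg _)) (le_add_of_nonneg_left (abs_nonneg _))
      (by positivity) (by positivity) (hC s u) (hD u t)

/-- The decomposable elements of degree `m`. -/
def decomposables (𝒜 : ℕ → Submodule ℝ H) (m : ℕ) : Submodule ℝ H :=
  Submodule.span ℝ {z | ∃ i j : ℕ, 0 < i ∧ 0 < j ∧ i + j = m ∧ ∃ x ∈ 𝒜 i, ∃ y ∈ 𝒜 j, x * y = z}

/-- Increments are multiplicative, so exponents add up: decomposable elements never need a
correction. -/
theorem decomposables_le_holderSubmodule {𝒜 : ℕ → Submodule ℝ H} {γ : ℝ} (hγ : 0 < γ)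
    {χ : I → (Character H)ˣ} {n : ℕ}
    (hχ : ∀ j < n, ∀ x ∈ 𝒜 j, x ∈ holderSubmodule (increment χ) (γ * j)) :
    decomposables 𝒜 n ≤ holderSubmodule (increment χ) (γ * n) := by
  refine Submodule.span_le.mpr ?_
  rintro _ ⟨i, j, hi, hj, hij, x, hx, y, hy, rfl⟩
  obtain ⟨C, hC⟩ := hχ i (by omega) x hx
  obtain ⟨D, hD⟩ := hχ j (by omega) y hy
  refine ⟨|C| * |D|, fun s t => ?_⟩
  rw [increment_mul, ← hij, Nat.cast_add, mul_add]
  exact mul_rpow_le_of_le (abs_nonneg _) (abs_nonneg _) le_rfl le_rfl (by positivity)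
    (by positivity) (hC s t) (hD s t)

variable (𝒜 : ℕ → Submodule ℝ H) [GradedAlgebra 𝒜]

/-- The projection onto the homogeneous component of degree `n`. -/
noncomputable def component (n : ℕ) : H →ₗ[ℝ] 𝒜 n :=
  DirectSum.component ℝ ℕ (fun n => 𝒜 n) n ∘ₗ (DirectSum.decomposeLinearEquiv 𝒜).toLinearMap

theorem component_of_mem {n : ℕ} {x : H} (hx : x ∈ 𝒜 n) : component 𝒜 n x = ⟨x, hx⟩ :=
  Subtype.ext (DirectSum.decompose_of_mem_same 𝒜 hx)

theorem component_of_ne {n m : ℕ} (h : m ≠ n) {x : H} (hx : x ∈ 𝒜 m) : component 𝒜 n x = 0 :=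
  Subtype.ext (DirectSum.decompose_of_mem_ne 𝒜 hx h)

/-- A sequence of characters that stabilizes in every degree converges to a character. -/
theorem Character.exists_limit (ψ : ℕ → Character H)
    (h : ∀ n, ∀ p ≤ n, ∀ x ∈ 𝒜 p, (ψ (n + 1)).lin x = (ψ n).lin x) :
    ∃ χ : Character H, ∀ n, ∀ p ≤ n, ∀ x ∈ 𝒜 p, χ.lin x = (ψ n).lin x := by
  have hψ : ∀ n, ∀ p ≤ n, ∀ x ∈ 𝒜 p, (ψ n).lin x = (ψ p).lin x := by
    intro n p hp x hx
    induction n, hp using Nat.le_induction with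
    | base => rfl
    | succ n hn ih => rw [h n p hn x hx, ih]
  let f : H →ₗ[ℝ] ℝ := DirectSum.toModule ℝ ℕ ℝ (fun n => (ψ n).lin ∘ₗ (𝒜 n).subtype) ∘ₗ
    (DirectSum.decomposeLinearEquiv 𝒜).toLinearMap
  have hf : ∀ n, ∀ x ∈ 𝒜 n, f x = (ψ n).lin x := by
    intro n x hx
    simp only [f, LinearMap.comp_apply, LinearEquiv.coe_coe, DirectSum.decomposeLinearEquiv_apply,
      DirectSum.decompose_of_mem 𝒜 hx]
    exact DirectSum.toModule_lof ℝ (M := fun n => 𝒜 n) n ⟨x, hx⟩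
  have hmul : (LinearMap.mul ℝ H).compr₂ f = (LinearMap.mul ℝ ℝ).compl₁₂ f f := by
    refine bilin_ext_homogeneous 𝒜 fun m n x hx y hy => ?_
    have hxy : x * y ∈ 𝒜 (m + n) := SetLike.GradedMul.mul_mem hx hy
    simp only [LinearMap.compr₂_apply, LinearMap.mul_apply', LinearMap.compl₁₂_apply]
    -- All three values can be read off from the single character `ψ (m + n)`, which is
    -- multiplicative.
    rw [hf _ _ hxy, hf m x hx, hf n y hy, ← hψ (m + n) m (by omega) x hx,
      ← hψ (m + n) n (by omega) y hy]
    exact map_mul (ψ (m + n)).ofConv x y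
  refine ⟨WithConv.toConv (AlgHom.ofLinearMap f ?_ fun x y =>
    LinearMap.congr_fun (LinearMap.congr_fun hmul x) y), fun n p hp x hx => ?_⟩
  · rw [hf 0 1 SetLike.GradedOne.one_mem]
    exact map_one (ψ 0).ofConv
  · rw [hψ n p hp x hx]
    exact hf p x hx

variable [IsLocallyFiniteConnectedHopf 𝒜]

/-- A finite family of infinitesimal characters of degree `m` that are coordinates modulo
decomposable elements. -/
theorem exists_infChar_coordinates {m : ℕ} (hm : 0 < m) :
    ∃ (r : ℕ) (u : Fin r → H) (φ : Fin r → H →ₗ[ℝ] ℝ), (∀ i, u i ∈ 𝒜 m) ∧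
      (∀ i, IsInfChar (φ i)) ∧ (∀ i n, n ≠ m → ∀ x ∈ 𝒜 n, φ i x = 0) ∧
      (∀ i j, φ i (u j) = if i = j then 1 else 0) ∧
      ∀ x ∈ 𝒜 m, x - ∑ i, φ i x • u i ∈ decomposables 𝒜 m := by
  have := IsLocallyFiniteConnectedHopf.locallyFinite (𝒜 := 𝒜) m
  -- The `φ i` are coordinates on the quotient by the decomposables, extended by zero to the other
  -- degrees; vanishing on products makes them infinitesimal characters.
  let W : Submodule ℝ (𝒜 m) := (decomposables 𝒜 m).comap (𝒜 m).subtype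
  let v := Module.finBasis ℝ (𝒜 m ⧸ W)
  choose u hu using fun i => W.mkQ_surjective (v i)
  let φ : Fin (Module.finrank ℝ (𝒜 m ⧸ W)) → H →ₗ[ℝ] ℝ := fun i =>
    v.coord i ∘ₗ W.mkQ ∘ₗ component 𝒜 m
  have hφ : ∀ i x (hx : x ∈ 𝒜 m), φ i x = v.repr (W.mkQ ⟨x, hx⟩) i := fun i x hx => by
    simp only [φ, LinearMap.comp_apply, component_of_mem 𝒜 hx, Module.Basis.coord_apply]
  have hφ0 : ∀ i n, n ≠ m → ∀ x ∈ 𝒜 n, φ i x = 0 := fun i n hn x hx => by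
    simp only [φ, LinearMap.comp_apply, component_of_ne 𝒜 hn hx, map_zero]
  have hdec : decomposables 𝒜 m ≤ 𝒜 m := by
    refine Submodule.span_le.mpr ?_
    rintro _ ⟨i, j, hi, hj, rfl, x, hx, y, hy, rfl⟩
    exact SetLike.GradedMul.mul_mem hx hy
  have hφd : ∀ i, ∀ x ∈ decomposables 𝒜 m, φ i x = 0 := fun i x hx => by
    have hxW : (⟨x, hdec hx⟩ : 𝒜 m) ∈ W := hx
    rw [hφ i x (hdec hx), Submodule.mkQ_apply, (Submodule.Quotient.mk_eq_zero W).mpr hxW, map_zero,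
      Finsupp.zero_apply]
  refine ⟨_, fun i => u i, φ, fun i => (u i).2, fun i => ?_, hφ0, ?_, ?_⟩
  · refine isInfChar_of_degree 𝒜 IsLocallyFiniteConnectedHopf.connected
      (fun n hn x hx => counit_eq_zero 𝒜 hn hx) hm (hφ0 i) ?_
    intro a b ha hb hab x hx y hy
    exact hφd i _ (Submodule.subset_span ⟨a, b, ha, hb, hab, x, hx, y, hy, rfl⟩)
  · intro i j
    rw [hφ i _ (u j).2, Subtype.coe_eta, hu, Module.Basis.repr_self, Finsupp.single_apply]
    simp only [eq_comm]
  · intro x hx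
    have h : (⟨x, hx⟩ - ∑ i, φ i x • u i : 𝒜 m) ∈ W := by
      rw [← Submodule.Quotient.mk_eq_zero, ← Submodule.mkQ_apply, map_sub, map_sum]
      simp only [map_smul, hu, hφ _ x hx, v.sum_repr, sub_self]
    have h' : ((⟨x, hx⟩ - ∑ i, φ i x • u i : 𝒜 m) : H) ∈ decomposables 𝒜 m := h
    simpa using h'

/-- Multiplying a path of characters by exponentials of infinitesimal characters of degree
`n + 1` adds the increments of these to the increments of degree `n + 1`. -/
theorem exists_twist {n : ℕ} (χ : I → (Character H)ˣ) (z : I → H →ₗ[ℝ] ℝ)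
    (hz : ∀ t, IsInfChar (z t)) (hz0 : ∀ t, ∀ p ≤ n, ∀ x ∈ 𝒜 p, z t x = 0) :
    ∃ χ' : I → (Character H)ˣ,
      (∀ t, ∀ p ≤ n, ∀ x ∈ 𝒜 p, (χ' t : Character H).lin x = (χ t : Character H).lin x) ∧
      ∀ s t, ∀ x ∈ 𝒜 (n + 1), increment χ' s t x = increment χ s t x + (z t x - z s x) := by
  let E : I → (Character H)ˣ := fun t => (expChar 𝒜 (hz t)).toUnit
  have hE : ∀ t, ∀ p ≤ n + 1, ∀ x ∈ 𝒜 p,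
      (E t : Character H).lin x = Coalgebra.counit (R := ℝ) x + z t x :=
    fun t p hp x hx => expChar_apply_of_degree 𝒜 (hz t) (hz0 t) hp hx
  have hE1 : ∀ t, ∀ p ≤ n, ∀ x ∈ 𝒜 p,
      (E t : Character H).lin x = ((1 : (Character H)ˣ) : Character H).lin x :=
    fun t p hp x hx => by
      rw [hE t p (by omega) x hx, hz0 t p hp x hx, add_zero]
      rfl
  have hE2 : ∀ t, ∀ p ≤ n, ∀ x ∈ 𝒜 p,
      (↑(E t)⁻¹ : Character H).lin x = Coalgebra.counit (R := ℝ) x :=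
    fun t p hp x hx => by
      rw [Character.inv_congr 𝒜 (hE1 t) p hp x hx, inv_one]
      rfl
  have hE3 : ∀ t, ∀ x ∈ 𝒜 (n + 1), (E t : Character H).lin x = z t x := fun t x hx => by
    rw [hE t _ le_rfl x hx, counit_eq_zero 𝒜 (Nat.succ_pos n) hx, zero_add]
  have hE0 : ∀ t, ∀ p, 0 < p → p < n + 1 → ∀ x ∈ 𝒜 p, (E t : Character H).lin x = 0 :=
    fun t p hp hpn x hx => by
      rw [hE1 t p (by omega) x hx]
      exact counit_eq_zero 𝒜 hp hx
  have hE0' : ∀ t, ∀ p, 0 < p → p < n + 1 → ∀ x ∈ 𝒜 p, (↑(E t)⁻¹ : Character H).lin x = 0 :=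
    fun t p hp hpn x hx => by
      rw [hE2 t p (by omega) x hx]
      exact counit_eq_zero 𝒜 hp hx
  have hE4 : ∀ t, ∀ x ∈ 𝒜 (n + 1), (↑(E t)⁻¹ : Character H).lin x = - z t x := fun t x hx => by
    have h := Character.mul_apply (E t : Character H) (↑(E t)⁻¹ : Character H) x
    rw [Units.mul_inv, Character.lin_one, counit_eq_zero 𝒜 (Nat.succ_pos n) hx, hE3 t x hx,
      tensorPair_eq_zero_left (hE0 t) _ (reducedComul_mem 𝒜 (Nat.succ_pos n) hx)] at h
    linarith
  refine ⟨fun t => χ t * E t, fun t p hp x hx => ?_, fun s t x hx => ?_⟩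
  · rw [Units.val_mul, Character.mul_congr 𝒜 (fun _ _ _ _ => rfl) (hE1 t) p hp x hx, Units.val_one,
      mul_one]
  -- The old increment gets multiplied by `E_s⁻¹` on the left and `E_t` on the right. Both vanish in
  -- degrees `1, …, n`, so the reduced coproduct contributes no mixed terms in degree `n + 1`.
  · have h : (↑(χ s * E s)⁻¹ : Character H) * ↑(χ t * E t) =
        ↑(E s)⁻¹ * (((↑(χ s)⁻¹ : Character H) * χ t) * E t) := by
      rw [mul_inv_rev]
      simp only [Units.val_mul, mul_assoc]
    have hr := reducedComul_mem 𝒜 (Nat.succ_pos n) hx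
    rw [increment, h, Character.mul_apply, Character.mul_apply, hE4 s x hx, hE3 t x hx,
      tensorPair_eq_zero_left (hE0' s) _ hr, tensorPair_eq_zero_right _ (hE0 t) hr, increment]
    ring

theorem increment_congr {n : ℕ} {χ χ' : I → (Character H)ˣ}
    (h : ∀ t, ∀ p ≤ n, ∀ x ∈ 𝒜 p, (χ' t : Character H).lin x = (χ t : Character H).lin x)
    (s t : I) : ∀ p ≤ n, ∀ x ∈ 𝒜 p, increment χ' s t x = increment χ s t x :=
  Character.mul_congr 𝒜 (Character.inv_congr 𝒜 (h s)) (h t)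

theorem mem_holderSubmodule_congr {n : ℕ} {χ χ' : I → (Character H)ˣ}
    (h : ∀ t, ∀ p ≤ n, ∀ x ∈ 𝒜 p, (χ' t : Character H).lin x = (χ t : Character H).lin x)
    {p : ℕ} (hp : p ≤ n) {x : H} (hx : x ∈ 𝒜 p) {e : ℝ}
    (hχ : x ∈ holderSubmodule (increment χ) e) : x ∈ holderSubmodule (increment χ') e := by
  obtain ⟨C, hC⟩ := hχ
  exact ⟨C, fun s t => by rw [increment_congr 𝒜 h s t p hp x hx]; exact hC s t⟩

/-- Lift of a Hölder path of characters by one degree. -/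
theorem exists_holder_lift {γ : ℝ} (hγ : 0 < γ) {n : ℕ} (hn : γ * (n + 1 : ℕ) ≠ 1)
    (χ : I → (Character H)ˣ)
    (hχ : ∀ j ≤ n, ∀ x ∈ 𝒜 j, x ∈ holderSubmodule (increment χ) (γ * j)) :
    ∃ χ' : I → (Character H)ˣ,
      (∀ t, ∀ p ≤ n, ∀ x ∈ 𝒜 p, (χ' t : Character H).lin x = (χ t : Character H).lin x) ∧
      ∀ j ≤ n + 1, ∀ x ∈ 𝒜 j, x ∈ holderSubmodule (increment χ') (γ * j) := by
  obtain ⟨r, u, φ, hu, hφ, hφ0, hφu, hsub⟩ :=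
    exists_infChar_coordinates 𝒜 (Nat.succ_pos n)
  have hsew : ∀ i, ∃ (z : I → ℝ) (K : ℝ), ∀ s t : I,
      |increment χ s t (u i) - (z t - z s)| ≤ K * |(t : ℝ) - s| ^ (γ * (n + 1 : ℕ)) := by
    intro i
    obtain ⟨C, hC⟩ := tensorPair_bound hγ (fun j hj => hχ j (Nat.lt_succ_iff.mp hj))
      (reducedComul_mem 𝒜 (Nat.succ_pos n) (hu i))
    refine exists_sewing (C := C) (by positivity) hn _ fun s v t => ?_
    rw [increment_chen χ s v t, sub_add_cancel_left, abs_neg]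
    exact hC s v t
  choose z K hz using hsew
  -- With this sign the twist subtracts the sewn increment on each `u i`, because the `φ i` are dual
  -- to the `u i`.
  let Z : I → H →ₗ[ℝ] ℝ := fun t => ∑ i, (-z i t) • φ i
  have hZ : ∀ t x, Z t x = ∑ i, -z i t * φ i x := fun t x => by
    simp [Z, LinearMap.sum_apply]
  have hZi : ∀ t, IsInfChar (Z t) := fun t x y => by
    simp only [hZ, Finset.sum_mul, Finset.mul_sum, ← Finset.sum_add_distrib]
    refine Finset.sum_congr rfl fun i _ => ?_
    rw [hφ i x y]
    ring
  obtain ⟨χ', h1, h2⟩ := exists_twist 𝒜 (n := n) χ Z hZi (fun t p hp x hx => by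
    rw [hZ]
    exact Finset.sum_eq_zero fun i _ => by rw [hφ0 i p (by omega) x hx, mul_zero])
  have hlow : ∀ j ≤ n, ∀ x ∈ 𝒜 j, x ∈ holderSubmodule (increment χ') (γ * j) :=
    fun j hj x hx => mem_holderSubmodule_congr 𝒜 h1 hj hx (hχ j hj x hx)
  refine ⟨χ', h1, fun j hj x hx => ?_⟩
  rcases Nat.le_or_eq_of_le_succ hj with hj | rfl
  · exact hlow j hj x hx
  have hd := decomposables_le_holderSubmodule hγ (n := n + 1)
    (fun j hj => hlow j (Nat.lt_succ_iff.mp hj)) (hsub x hx)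
  have hui : ∀ i, u i ∈ holderSubmodule (increment χ') (γ * (n + 1 : ℕ)) := by
    intro i
    refine ⟨K i, fun s t => ?_⟩
    rw [h2 s t (u i) (hu i), hZ, hZ]
    have h3 : ∀ t, ∑ j, -z j t * φ j (u i) = - z i t := fun t => by
      simp [hφu]
    rw [h3, h3, show increment χ s t (u i) + (-z i t - -z i s) =
      increment χ s t (u i) - (z i t - z i s) by ring]
    exact hz i s t
  -- The decomposable part is controlled by multiplicativity, the combination of the `u i` by
  -- sewing.
  rw [← sub_add_cancel x (∑ i, φ i x • u i)]
  exact Submodule.add_mem _ hd (Submodule.sum_mem _ fun i _ => Submodule.smul_mem _ _ (hui i))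

/-- Hölder lift of a Hölder path of degree one functionals to the characters of a locally finite
graded connected Hopf algebra. -/
theorem exists_holder_character_path {γ : ℝ} (hγ0 : 0 < γ) (hγ : ∀ n : ℕ, γ⁻¹ ≠ n)
    (ξ : I → H →ₗ[ℝ] ℝ) (hξ : ∀ x ∈ 𝒜 1, IsHolderFun γ fun t => ξ t x) :
    ∃ χ : I → (Character H)ˣ,
      (∀ n, ∀ x ∈ 𝒜 n, x ∈ holderSubmodule (increment χ) (γ * n)) ∧
      ∀ x ∈ 𝒜 1, ∀ s t, increment χ s t x = ξ t x - ξ s x := by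
  have hγn : ∀ n : ℕ, γ * n ≠ 1 := fun n h => hγ n (inv_eq_of_mul_eq_one_right h)
  let P : ℕ → (I → (Character H)ˣ) → Prop := fun n χ =>
    ∀ j ≤ n, ∀ x ∈ 𝒜 j, x ∈ holderSubmodule (increment χ) (γ * j)
  -- the first level
  let ζ : I → H →ₗ[ℝ] ℝ := fun t => ξ t ∘ₗ (𝒜 1).subtype ∘ₗ component 𝒜 1
  have hζ : ∀ t, ∀ x ∈ 𝒜 1, ζ t x = ξ t x := fun t x hx => by
    simp only [ζ, LinearMap.comp_apply, component_of_mem 𝒜 hx, Submodule.subtype_apply]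
  have hζ0 : ∀ t n, n ≠ 1 → ∀ x ∈ 𝒜 n, ζ t x = 0 := fun t n hn x hx => by
    simp only [ζ, LinearMap.comp_apply, component_of_ne 𝒜 hn hx, map_zero]
  obtain ⟨χ₁, -, hχ₁⟩ := exists_twist 𝒜 (n := 0) (fun _ => (1 : (Character H)ˣ)) ζ
    (fun t => isInfChar_of_degree 𝒜 IsLocallyFiniteConnectedHopf.connected
      (fun n hn x hx => counit_eq_zero 𝒜 hn hx) one_pos (hζ0 t)
      -- Degree one contains no product of two elements of positive degree, so every functional of
      -- degree one is admissible.
      (fun i j hi hj hij => by omega))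
    (fun t p hp => hζ0 t p (by omega))
  have hχ₁' : ∀ x ∈ 𝒜 1, ∀ s t, increment χ₁ s t x = ξ t x - ξ s x := by
    intro x hx s t
    have h : increment (fun _ => (1 : (Character H)ˣ)) s t x = 0 := by
      rw [increment, inv_one, Units.val_one, one_mul, Character.lin_one]
      exact counit_eq_zero 𝒜 one_pos hx
    rw [hχ₁ s t x hx, h, hζ t x hx, hζ s x hx, zero_add]
  have hP₁ : P 1 χ₁ := by
    intro j hj x hx
    rcases Nat.le_one_iff_eq_zero_or_eq_one.mp hj with rfl | rfl
    · obtain ⟨c, rfl⟩ := (mem_zero_iff 𝒜).mp hx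
      refine Submodule.smul_mem _ _ ⟨1, fun s t => ?_⟩
      have : increment χ₁ s t 1 = 1 :=
        map_one ((↑(χ₁ s)⁻¹ : Character H) * χ₁ t).ofConv
      simp [this]
    · obtain ⟨C, hC⟩ := hξ x hx
      refine ⟨C, fun s t => ?_⟩
      rw [hχ₁' x hx, Nat.cast_one, mul_one]
      exact hC s t
  -- the higher levels
  have hstep : ∀ n (χ : {χ // P (n + 1) χ}), ∃ χ' : {χ // P (n + 1 + 1) χ},
      ∀ t, ∀ p ≤ n + 1, ∀ x ∈ 𝒜 p,
        (χ'.1 t : Character H).lin x = (χ.1 t : Character H).lin x := by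
    rintro n ⟨χ, hχ⟩
    obtain ⟨χ', h, h'⟩ := exists_holder_lift 𝒜 hγ0 (hγn (n + 1 + 1)) χ hχ
    exact ⟨⟨χ', h'⟩, h⟩
  choose next hnext using hstep
  -- The index is shifted: `seq n` is controlled through degree `n + 1`, with the first level as
  -- `seq 0`.
  let seq : ∀ n, {χ // P (n + 1) χ} := fun n => Nat.rec ⟨χ₁, hP₁⟩ next n
  have hseq : ∀ n t, ∀ p ≤ n + 1, ∀ x ∈ 𝒜 p,
      ((seq (n + 1)).1 t : Character H).lin x = ((seq n).1 t : Character H).lin x :=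
    fun n => hnext n (seq n)
  have hlim : ∀ t, ∃ ψ : Character H, ∀ n, ∀ p ≤ n, ∀ x ∈ 𝒜 p,
      ψ.lin x = ((seq n).1 t : Character H).lin x := fun t =>
    Character.exists_limit 𝒜 (fun n => ((seq n).1 t : Character H))
      fun n p hp => hseq n t p (by omega)
  choose ψ hψ using hlim
  have hχ : ∀ n t, ∀ p ≤ n, ∀ x ∈ 𝒜 p,
      ((ψ t).toUnit : Character H).lin x = ((seq n).1 t : Character H).lin x :=
    fun n t => hψ t n
  refine ⟨fun t => (ψ t).toUnit, fun n x hx => ?_, fun x hx s t => ?_⟩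
  · exact mem_holderSubmodule_congr 𝒜 (hχ n) le_rfl hx ((seq n).2 n (Nat.le_succ n) x hx)
  · rw [increment_congr 𝒜 (hχ 1) s t 1 le_rfl x hx]
    refine (increment_congr 𝒜 (n := 1) (hseq 0) s t 1 le_rfl x hx).trans ?_
    exact hχ₁' x hx s t

end Paths

-- Truncated paths and the homogeneous norm.

section HolderPaths

variable {H : Type*} [Ring H] [HopfAlgebra ℝ H]
variable (𝒜 : ℕ → Submodule ℝ H) [GradedAlgebra 𝒜]
variable (b : ∀ n, Module.Basis (Fin (Module.finrank ℝ (𝒜 n))) ℝ (𝒜 n))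

theorem normConst_nonneg (N : ℕ) : 0 ≤ normConst 𝒜 b N :=
  Real.iSup_nonneg fun _ => Finset.sum_nonneg fun _ _ => abs_nonneg _

/-- The `k`-th root turns `|t - s|^(γ k)` into `|t - s|^γ`. Only finitely many basis vectors are
involved, and sums of their constants dominate the maxima. -/
theorem exists_levelNorm_root_bound {γ : ℝ} (N : ℕ) {F : I → I → H →ₗ[ℝ] ℝ}
    (hF : ∀ n ≤ N, ∀ x ∈ 𝒜 n, x ∈ holderSubmodule F (γ * n)) :
    ∃ C : ℝ, ∀ s t : I, (⨆ k : Fin N, ((((k : ℕ) + 1).factorial : ℝ) *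
      levelNorm 𝒜 b N ((k : ℕ) + 1) (F s t)) ^ (1 / (((k : ℕ) : ℝ) + 1))) ≤
        C * |(t : ℝ) - s| ^ γ := by
  choose C hC using fun (k : Fin N) (i : Fin (Module.finrank ℝ (𝒜 ((k : ℕ) + 1)))) =>
    hF ((k : ℕ) + 1) k.2 (b _ i : H) (b _ i).2
  let K : Fin N → ℝ := fun k => ((((k : ℕ) + 1).factorial : ℝ) *
    (normConst 𝒜 b N * ∑ i, |C k i|)) ^ (1 / (((k : ℕ) : ℝ) + 1))
  have hD := normConst_nonneg 𝒜 b N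
  have hK : ∀ k, 0 ≤ K k := fun k => by positivity
  refine ⟨∑ k, K k, fun s t => ?_⟩
  have hr : 0 ≤ |(t : ℝ) - s| := abs_nonneg _
  refine Real.iSup_le (fun k => ?_)
    (mul_nonneg (Finset.sum_nonneg fun k _ => hK k) (by positivity))
  refine le_trans ?_ (mul_le_mul_of_nonneg_right
    (Finset.single_le_sum (fun k _ => hK k) (Finset.mem_univ k)) (by positivity))
  have hk : (((k : ℕ) : ℝ) + 1) ≠ 0 := by positivity
  have h1 : (⨆ i, |F s t (b ((k : ℕ) + 1) i : H)|) ≤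
      (∑ i, |C k i|) * |(t : ℝ) - s| ^ (γ * ((k : ℕ) + 1 : ℕ)) := by
    refine Real.iSup_le (fun i => (hC k i s t).trans ?_) (by positivity)
    refine mul_le_mul_of_nonneg_right ((le_abs_self _).trans ?_) (by positivity)
    exact Finset.single_le_sum (f := fun i => |C k i|) (fun i _ => abs_nonneg _)
      (Finset.mem_univ i)
  have h2 : 0 ≤ levelNorm 𝒜 b N ((k : ℕ) + 1) (F s t) :=
    mul_nonneg hD (Real.iSup_nonneg fun i => abs_nonneg _)
  have h3 : (((k : ℕ) + 1).factorial : ℝ) * levelNorm 𝒜 b N ((k : ℕ) + 1) (F s t) ≤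
      ((((k : ℕ) + 1).factorial : ℝ) * (normConst 𝒜 b N * ∑ i, |C k i|)) *
        |(t : ℝ) - s| ^ (γ * ((k : ℕ) + 1 : ℕ)) := by
    rw [mul_assoc, mul_assoc (normConst 𝒜 b N)]
    exact mul_le_mul_of_nonneg_left (mul_le_mul_of_nonneg_left h1 hD) (by positivity)
  calc _ ≤ (((((k : ℕ) + 1).factorial : ℝ) * (normConst 𝒜 b N * ∑ i, |C k i|)) *
        |(t : ℝ) - s| ^ (γ * ((k : ℕ) + 1 : ℕ))) ^ (1 / (((k : ℕ) : ℝ) + 1)) :=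
        Real.rpow_le_rpow (by positivity) h3 (by positivity)
    _ = K k * |(t : ℝ) - s| ^ γ := by
        rw [Real.mul_rpow (by positivity) (by positivity), ← Real.rpow_mul hr]
        congr 2
        push_cast
        field_simp

variable [IsLocallyFiniteConnectedHopf 𝒜]

theorem dualTrunc_counit (N : ℕ) :
    dualTrunc 𝒜 N (Coalgebra.counit (R := ℝ)) = Coalgebra.counit := by
  refine linearMap_ext_homogeneous 𝒜 fun n x hx => ?_
  rcases le_or_gt n N with hn | hn
  · exact dualTrunc_apply_of_le 𝒜 _ hn hx
  · rw [dualTrunc_apply_of_lt 𝒜 _ hn hx, counit_eq_zero 𝒜 (by omega) hx]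

theorem dualInv_dualTrunc (N : ℕ) (f : H →ₗ[ℝ] ℝ) :
    dualInv (dualTrunc 𝒜 N f) = dualTrunc 𝒜 N (dualInv f) := by
  refine linearMap_ext_homogeneous 𝒜 fun n x hx => ?_
  have hS := antipode_mem 𝒜 n x hx
  rcases le_or_gt n N with hn | hn
  · rw [dualTrunc_apply_of_le 𝒜 _ hn hx]
    exact dualTrunc_apply_of_le 𝒜 _ hn hS
  · rw [dualTrunc_apply_of_lt 𝒜 _ hn hx]
    exact dualTrunc_apply_of_lt 𝒜 _ hn hS

theorem truncMul_dualTrunc (N : ℕ) (f g : H →ₗ[ℝ] ℝ) :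
    truncMul 𝒜 N (dualTrunc 𝒜 N f) (dualTrunc 𝒜 N g) = dualTrunc 𝒜 N (starProd f g) :=
  dualTrunc_congr 𝒜 fun _ hn _ hx => starProd_congr 𝒜
    (fun _ hp _ ha => dualTrunc_apply_of_le 𝒜 f (hp.trans hn) ha)
    (fun _ hp _ ha => dualTrunc_apply_of_le 𝒜 g (hp.trans hn) ha) hx

theorem dualInv_increment (χ : I → (Character H)ˣ) (s t : I) :
    dualInv (increment χ s t) = increment χ t s := by
  have h := Character.lin_inv ((χ s)⁻¹ * χ t)
  rw [mul_inv_rev, inv_inv] at h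
  exact h.symm

/-- Left translation cancels, so a path can be normalized to start at the counit without changing
its increments. -/
theorem starProd_dualInv_increment (χ : I → (Character H)ˣ) (r s t : I) :
    starProd (dualInv (increment χ r t)) (increment χ r s) = increment χ t s := by
  rw [dualInv_increment]
  simp only [increment]
  rw [← Character.lin_mul, mul_assoc, ← mul_assoc (χ r : Character H), Units.mul_inv, one_mul]

/-- Existence of Hölder paths over Hölder paths in a truncated character group. -/
theorem exists_hopfHolderPath {γ : ℝ} (hγ0 : 0 < γ) (hγ1 : γ < 1) (hγ : ∀ n : ℕ, γ⁻¹ ≠ n)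
    (x : Fin (Module.finrank ℝ (𝒜 1)) → I → ℝ) (hx : ∀ i, IsHolderFun γ (x i)) :
    ∃ X : I → H →ₗ[ℝ] ℝ, IsHopfHolderPath 𝒜 b γ X ∧
      ∀ i t, X t (b 1 i : H) = x i t - x i 0 := by
  let ξ : I → H →ₗ[ℝ] ℝ := fun t => (b 1).constr ℝ (fun i => x i t) ∘ₗ component 𝒜 1
  have hξ : ∀ t y (hy : y ∈ 𝒜 1), ξ t y = ∑ i, (b 1).repr ⟨y, hy⟩ i * x i t := fun t y hy => by
    simp only [ξ, LinearMap.comp_apply, component_of_mem 𝒜 hy, Module.Basis.constr_apply_fintype,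
      Module.Basis.equivFun_apply, smul_eq_mul]
  obtain ⟨χ, hχ, hχ1⟩ := exists_holder_character_path 𝒜 hγ0 hγ ξ (by
    intro y hy
    choose C hC using hx
    refine ⟨∑ i, |(b 1).repr ⟨y, hy⟩ i| * C i, fun s t => ?_⟩
    simp only [hξ _ y hy]
    rw [← Finset.sum_sub_distrib, Finset.sum_mul]
    refine (Finset.abs_sum_le_sum_abs _ _).trans (Finset.sum_le_sum fun i _ => ?_)
    rw [← mul_sub, abs_mul, mul_assoc]
    exact mul_le_mul_of_nonneg_left (hC i s t) (abs_nonneg _))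
  set N := ⌊γ⁻¹⌋₊ with hN
  -- Since `γ < 1`, degree one survives the truncation.
  have hN1 : 1 ≤ N := Nat.le_floor (by
    rw [Nat.cast_one]
    exact one_le_inv_iff₀.mpr ⟨hγ0, hγ1.le⟩)
  refine ⟨fun t => dualTrunc 𝒜 N (increment χ 0 t), ⟨fun t => ?_, ?_, ?_⟩, fun i t => ?_⟩
  · exact dualTrunc_mem_truncGroup 𝒜 _ _
  · have : increment χ 0 0 = Coalgebra.counit := by
      rw [increment, Units.inv_mul, Character.lin_one]
    rw [this, dualTrunc_counit]
  · have hF : ∀ n ≤ N, ∀ y ∈ 𝒜 n,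
        y ∈ holderSubmodule (fun s t => dualTrunc 𝒜 N (increment χ s t)) (γ * n) := by
      intro n hn y hy
      obtain ⟨C, hC⟩ := hχ n y hy
      exact ⟨C, fun s t => by rw [dualTrunc_apply_of_le 𝒜 _ hn hy]; exact hC s t⟩
    obtain ⟨C, hC⟩ := exists_levelNorm_root_bound 𝒜 b N hF
    refine ⟨C + C, fun s t => ?_⟩
    -- The distance involves `X_t⁻¹ ⋆ X_s`, the increment from `t` to `s`, and its inverse, the
    -- increment from `s` to `t`: one bound for each half of the homogeneous norm.
    have h := add_le_add (hC t s) (hC s t)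
    rw [abs_sub_comm (s : ℝ) t, ← add_mul] at h
    rw [truncDist, dualInv_dualTrunc, truncMul_dualTrunc, starProd_dualInv_increment, homNorm,
      dualInv_dualTrunc, dualInv_increment]
    exact h
  · rw [dualTrunc_apply_of_le 𝒜 _ hN1 (b 1 i).2, hχ1 _ (b 1 i).2, hξ _ _ (b 1 i).2,
      hξ _ _ (b 1 i).2]
    simp [Finsupp.single_apply]

end HolderPaths

-- Counting nodes of trees and forests.

theorem DecTree.size_graft {A : Type} (a : A) (f : Multiset (DecTree A)) :
    (DecTree.graft a f).size = forestSize f + 1 := by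
  have h : ∀ τ : DecTree A, PlanarTree.size τ.out = τ.size := fun τ => by
    conv_rhs => rw [← Quotient.out_eq τ]
    rfl
  change PlanarTree.size (PlanarTree.node a (f.toList.map DecTree.out)) = _
  rw [PlanarTree.size, PlanarTree.sizeList_eq, List.map_map, forestSize]
  conv_rhs => rw [← Multiset.coe_toList f, Multiset.map_coe, Multiset.sum_coe]
  congr 3
  exact funext h

theorem DecTree.exists_graft {A : Type} (τ : DecTree A) : ∃ a f, τ = DecTree.graft a f :=
  BCK.tree_induct (P := fun τ => ∃ a f, τ = DecTree.graft a f) (fun a f _ => ⟨a, f, rfl⟩) τ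

theorem DecTree.size_pos {A : Type} (τ : DecTree A) : 0 < τ.size := by
  obtain ⟨a, f, rfl⟩ := τ.exists_graft
  rw [DecTree.size_graft]
  exact Nat.succ_pos _

/-- The decoration of the root of a planar tree. -/
def PlanarTree.root {A : Type} : PlanarTree A → A
  | .node a _ => a

theorem PlanarTree.root_eq_of_iso {A : Type} {t u : PlanarTree A} (h : PlanarTree.Iso t u) :
    t.root = u.root := by
  induction h with
  | refl t => rfl
  | symm _ ih => exact ih.symm
  | trans _ _ ih₁ ih₂ => exact ih₁.trans ih₂
  | perm a h => rfl
  | branch a l _ ih => rfl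

theorem DecTree.single_injective {A : Type} : Function.Injective (DecTree.single (A := A)) := by
  intro a b h
  have := PlanarTree.root_eq_of_iso (Quotient.exact h)
  simpa [PlanarTree.root] using this

@[simp] theorem forestSize_zero {A : Type} : forestSize (0 : Multiset (DecTree A)) = 0 := rfl

@[simp] theorem forestSize_cons {A : Type} (τ : DecTree A) (f : Multiset (DecTree A)) :
    forestSize (τ ::ₘ f) = τ.size + forestSize f := by
  simp [forestSize]

theorem forestSize_eq_zero {A : Type} {f : Multiset (DecTree A)} (h : forestSize f = 0) :
    f = 0 := by
  induction f using Multiset.induction with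
  | empty => rfl
  | cons τ f _ =>
    rw [forestSize_cons] at h
    have := τ.size_pos
    omega

/-- A nonempty forest is determined by the root decoration of one of its trees, the forest grafted
there and the remaining trees; both smaller forests have lost at least that root. -/
theorem finite_forestSize_lt {A : Type} [Finite A] (n : ℕ) :
    {f : Multiset (DecTree A) | forestSize f < n}.Finite := by
  induction n with
  | zero => simp
  | succ n ih =>
    have h := ((Set.finite_univ (α := A)).prod (ih.prod ih)).image
      fun p => DecTree.graft p.1 p.2.1 ::ₘ p.2.2
    refine ((Set.finite_singleton 0).union h).subset fun f hf => ?_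
    induction f using Multiset.induction with
    | empty => exact Or.inl rfl
    | cons τ f _ =>
      obtain ⟨a, g, rfl⟩ := τ.exists_graft
      rw [Set.mem_ofPred_eq, forestSize_cons, DecTree.size_graft] at hf
      refine Or.inr ⟨(a, g, f), ⟨Set.mem_univ a, ?_, ?_⟩, rfl⟩
      · change forestSize g < n
        omega
      · change forestSize f < n
        omega

-- The grading by nodes, and branched rough paths.

namespace BCK

variable {A : Type}

/-- The grading of the Butcher–Connes–Kreimer Hopf algebra by the number of nodes. -/
noncomputable def grading (A : Type) (n : ℕ) : Submodule ℝ (BCK A) :=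
  MvPolynomial.weightedHomogeneousSubmodule ℝ (DecTree.size (A := A)) n

noncomputable instance : GradedAlgebra (grading A) :=
  MvPolynomial.weightedGradedAlgebra ℝ (DecTree.size (A := A))

theorem tree_mem_grading (τ : DecTree A) : tree τ ∈ grading A τ.size :=
  MvPolynomial.isWeightedHomogeneous_X ℝ DecTree.size τ

theorem forest_mem_grading (f : Multiset (DecTree A)) : forest f ∈ grading A (forestSize f) := by
  induction f using Multiset.induction with
  | empty => exact SetLike.GradedOne.one_mem
  | cons τ f ih =>
    rw [forest, Multiset.map_cons, Multiset.prod_cons, forestSize_cons]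
    exact SetLike.GradedMul.mul_mem (tree_mem_grading τ) ih

/-- Forests form a basis of homogeneous elements, so projecting an expansion in forests to degree
`n` keeps exactly the forests with `n` nodes. -/
theorem grading_eq_span (n : ℕ) :
    grading A n = Submodule.span ℝ (forest '' {f : Multiset (DecTree A) | forestSize f = n}) := by
  apply le_antisymm
  · intro p hp
    have hp' : p ∈ (⊤ : Submodule ℝ (BCK A)) := trivial
    rw [← forestBasis.span_eq] at hp'
    have key : GradedAlgebra.proj (grading A) n p ∈
        Submodule.span ℝ (forest '' {f : Multiset (DecTree A) | forestSize f = n}) := by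
      refine Submodule.span_induction (p := fun p _ => GradedAlgebra.proj (grading A) n p ∈
        Submodule.span ℝ (forest '' {f : Multiset (DecTree A) | forestSize f = n})) ?_ (by simp)
        (fun x y _ _ hx hy => by rw [map_add]; exact Submodule.add_mem _ hx hy)
        (fun c x _ hx => by rw [map_smul]; exact Submodule.smul_mem _ _ hx) hp'
      rintro _ ⟨f, rfl⟩
      rw [forestBasis_apply, GradedAlgebra.proj_apply]
      by_cases hf : forestSize f = n
      · rw [← hf, DirectSum.decompose_of_mem_same _ (forest_mem_grading f)]
        exact Submodule.subset_span ⟨f, rfl, rfl⟩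
      · rw [DirectSum.decompose_of_mem_ne _ (forest_mem_grading f) hf]
        exact Submodule.zero_mem _
    rwa [GradedAlgebra.proj_apply, DirectSum.decompose_of_mem_same _ hp] at key
  · refine Submodule.span_le.mpr ?_
    rintro _ ⟨f, rfl, rfl⟩
    exact forest_mem_grading f

theorem graftLin_mem_grading (a : A) {n : ℕ} {x : BCK A} (hx : x ∈ grading A n) :
    graftLin a x ∈ grading A (n + 1) := by
  rw [grading_eq_span] at hx
  refine Submodule.span_induction (p := fun x _ => graftLin a x ∈ grading A (n + 1)) ?_ (by simp)
    (fun x y _ _ hx hy => by rw [map_add]; exact Submodule.add_mem _ hx hy)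
    (fun c x _ hx => by rw [map_smul]; exact Submodule.smul_mem _ _ hx) hx
  rintro _ ⟨f, rfl, rfl⟩
  rw [graftLin_forest, ← DecTree.size_graft a f]
  exact tree_mem_grading _

/-- The elements of total degree `n` of the tensor square. -/
noncomputable def tensorGrading (A : Type) (n : ℕ) : Submodule ℝ (BCK A ⊗[ℝ] BCK A) :=
  Submodule.span ℝ {t | ∃ p q : ℕ, p + q = n ∧ ∃ a ∈ grading A p, ∃ b ∈ grading A q,
    a ⊗ₜ[ℝ] b = t}

theorem tensorGrading_mul {m n : ℕ} {s t : BCK A ⊗[ℝ] BCK A} (hs : s ∈ tensorGrading A m)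
    (ht : t ∈ tensorGrading A n) : s * t ∈ tensorGrading A (m + n) := by
  have h : tensorGrading A m * tensorGrading A n ≤ tensorGrading A (m + n) := by
    rw [tensorGrading, tensorGrading, Submodule.span_mul_span]
    refine Submodule.span_le.mpr ?_
    rintro _ ⟨_, ⟨p, q, hpq, a, ha, b, hb, rfl⟩, _, ⟨p', q', hpq', a', ha', b', hb', rfl⟩, rfl⟩
    refine Submodule.subset_span ⟨p + p', q + q', by omega, a * a',
      SetLike.GradedMul.mul_mem ha ha', b * b', SetLike.GradedMul.mul_mem hb hb', ?_⟩
    exact (Algebra.TensorProduct.tmul_mul_tmul a a' b b').symm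
  exact h (Submodule.mul_mem_mul hs ht)

theorem lTensor_graftLin_mem (a : A) {n : ℕ} {t : BCK A ⊗[ℝ] BCK A} (ht : t ∈ tensorGrading A n) :
    (graftLin a).lTensor (BCK A) t ∈ tensorGrading A (n + 1) := by
  refine Submodule.span_induction
    (p := fun t _ => (graftLin a).lTensor (BCK A) t ∈ tensorGrading A (n + 1)) ?_ (by simp)
    (fun x y _ _ hx hy => by rw [map_add]; exact Submodule.add_mem _ hx hy)
    (fun c x _ hx => by rw [map_smul]; exact Submodule.smul_mem _ _ hx) ht
  rintro _ ⟨p, q, hpq, x, hx, y, hy, rfl⟩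
  exact Submodule.subset_span ⟨p, q + 1, by omega, x, hx, graftLin a y,
    graftLin_mem_grading a hy, rfl⟩

theorem comulHom_forest_mem_of_tree {f : Multiset (DecTree A)}
    (h : ∀ τ ∈ f, comulHom (tree τ) ∈ tensorGrading A τ.size) :
    comulHom (forest f) ∈ tensorGrading A (forestSize f) := by
  induction f using Multiset.induction with
  | empty =>
    rw [forest, Multiset.map_zero, Multiset.prod_zero, map_one]
    exact Submodule.subset_span ⟨0, 0, rfl, 1, SetLike.GradedOne.one_mem, 1,
      SetLike.GradedOne.one_mem, rfl⟩
  | cons τ f ih =>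
    rw [forest, Multiset.map_cons, Multiset.prod_cons, forestSize_cons, map_mul]
    exact tensorGrading_mul (h τ (Multiset.mem_cons_self τ f))
      (ih fun ρ hρ => h ρ (Multiset.mem_cons_of_mem hρ))

/-- Both terms of the recursion for `Δ [x]_a` graft exactly once and so raise the total degree by
one; multiplicativity passes from the branches to the forest they form. -/
theorem comulHom_tree_mem (τ : DecTree A) : comulHom (tree τ) ∈ tensorGrading A τ.size := by
  refine tree_induct (P := fun τ => comulHom (tree τ) ∈ tensorGrading A τ.size) ?_ τ
  intro a f hf
  rw [← graftLin_forest, comulHom_graftLin, DecTree.size_graft]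
  refine Submodule.add_mem _ (Submodule.subset_span ⟨forestSize f + 1, 0, rfl, _,
    graftLin_mem_grading a (forest_mem_grading f), 1, SetLike.GradedOne.one_mem, rfl⟩) ?_
  exact lTensor_graftLin_mem a (comulHom_forest_mem_of_tree hf)

theorem comulHom_mem {n : ℕ} {x : BCK A} (hx : x ∈ grading A n) :
    comulHom x ∈ tensorGrading A n := by
  rw [grading_eq_span] at hx
  refine Submodule.span_induction (p := fun x _ => comulHom x ∈ tensorGrading A n) ?_ (by simp)
    (fun x y _ _ hx hy => by rw [map_add]; exact Submodule.add_mem _ hx hy)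
    (fun c x _ hx => by rw [map_smul]; exact Submodule.smul_mem _ _ hx) hx
  rintro _ ⟨f, rfl, rfl⟩
  exact comulHom_forest_mem_of_tree fun τ _ => comulHom_tree_mem τ

instance [Finite A] : IsLocallyFiniteConnectedHopf (grading A) where
  connected := by
    have h : {f : Multiset (DecTree A) | forestSize f = 0} = {0} :=
      Set.ext fun f => ⟨forestSize_eq_zero, fun h => by rw [Set.mem_singleton_iff.mp h]; rfl⟩
    rw [grading_eq_span, h, Set.image_singleton]
    rfl
  locallyFinite n := by
    rw [grading_eq_span]
    refine FiniteDimensional.span_of_finite ℝ (Set.Finite.image _ ?_)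
    exact (finite_forestSize_lt (n + 1)).subset fun f (hf : forestSize f = n) =>
      show forestSize f < n + 1 by omega
  comul_mem n x hx := by
    have h : tensorGrading A n ≤ ⨆ (p : ℕ) (q : ℕ) (_ : p + q = n),
        LinearMap.range (TensorProduct.map (grading A p).subtype (grading A q).subtype) := by
      refine Submodule.span_le.mpr ?_
      rintro _ ⟨p, q, hpq, a, ha, b, hb, rfl⟩
      exact Submodule.mem_iSup_of_mem p (Submodule.mem_iSup_of_mem q
        (Submodule.mem_iSup_of_mem hpq
          ⟨(⟨a, ha⟩ : grading A p) ⊗ₜ[ℝ] (⟨b, hb⟩ : grading A q), rfl⟩))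
    exact h (comulHom_mem hx)

/-- Existence of branched rough paths over Hölder paths. -/
theorem exists_branchedRoughPath [Finite A] {γ : ℝ} (hγ0 : 0 < γ) (hγ : ∀ n : ℕ, γ⁻¹ ≠ n)
    (x : A → I → ℝ) (hx : ∀ i, IsHolderFun γ (x i)) :
    ∃ X : I → I → WithConv (BCK A →ₐ[ℝ] ℝ), IsBranchedRoughPath γ X ∧
      ∀ i s t, (X s t).ofConv (tree (DecTree.single i)) = x i t - x i s := by
  classical
  -- The given paths on one-node forests and `0` on all others; the chosen decoration is unique by
  -- `DecTree.single_injective`.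
  let g : I → Multiset (DecTree A) → ℝ := fun t f =>
    if h : ∃ i, f = {DecTree.single i} then x h.choose t else 0
  have hg : ∀ t i, g t {DecTree.single i} = x i t := by
    intro t i
    have h : ∃ j, ({DecTree.single i} : Multiset (DecTree A)) = {DecTree.single j} := ⟨i, rfl⟩
    have hi : h.choose = i :=
      (DecTree.single_injective (Multiset.singleton_inj.mp h.choose_spec)).symm
    simp only [g, dif_pos h, hi]
  let ξ : I → BCK A →ₗ[ℝ] ℝ := fun t => forestBasis.constr ℝ (g t)
  have hξ : ∀ t f, ξ t (forest f) = g t f := fun t f => by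
    rw [← forestBasis_apply]
    exact Module.Basis.constr_basis _ _ _ _
  have htop : ∀ y, y ∈ holderSubmodule (fun s t => ξ t - ξ s) γ := by
    intro y
    have hy : y ∈ Submodule.span ℝ (Set.range (forestBasis (A := A))) := by
      rw [Module.Basis.span_eq]
      trivial
    refine (Submodule.span_le.mpr ?_) hy
    rintro _ ⟨f, rfl⟩
    rw [forestBasis_apply]
    by_cases h : ∃ i, f = {DecTree.single i}
    · obtain ⟨i, rfl⟩ := h
      obtain ⟨C, hC⟩ := hx i
      refine ⟨C, fun s t => ?_⟩
      rw [LinearMap.sub_apply, hξ, hξ, hg, hg]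
      exact hC s t
    · refine ⟨0, fun s t => ?_⟩
      rw [LinearMap.sub_apply, hξ, hξ]
      simp [g, h]
  obtain ⟨χ, hχ, hχ1⟩ := exists_holder_character_path (grading A) hγ0 hγ ξ
    fun y _ => htop y
  refine ⟨fun s t => (↑(χ s)⁻¹ : Character (BCK A)) * χ t, ⟨fun t => ?_, fun s u t => ?_,
    fun f => ?_⟩, fun i s t => ?_⟩
  · exact Units.inv_mul (χ t)
  · rw [mul_assoc, ← mul_assoc (χ u : Character (BCK A)), Units.mul_inv, one_mul]
  -- The lift is controlled in every degree, so no separate extension beyond degree `⌊1/γ⌋` is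
  -- needed.
  · exact hχ _ _ (forest_mem_grading f)
  · have hf : forest {DecTree.single i} = tree (DecTree.single i) := by simp [forest]
    have h1 : tree (DecTree.single i) ∈ grading A 1 := by
      have := tree_mem_grading (DecTree.single i)
      rwa [DecTree.single, DecTree.size_graft] at this
    have := hχ1 _ h1 s t
    rw [← hf, hξ, hξ, hg, hg] at this
    rw [← hf]
    exact this

end BCK

theorem mainTheorem4 (γ : ℝ) (hγ0 : 0 < γ) (hγ1 : γ < 1) (hγ : ∀ n : ℕ, γ⁻¹ ≠ n) :
    (∀ (H : Type*) [Ring H] [HopfAlgebra ℝ H] (𝒜 : ℕ → Submodule ℝ H) [GradedAlgebra 𝒜]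
        [IsLocallyFiniteConnectedHopf 𝒜]
        (b : ∀ n, Module.Basis (Fin (Module.finrank ℝ (𝒜 n))) ℝ (𝒜 n))
        (x : Fin (Module.finrank ℝ (𝒜 1)) → I → ℝ),
        (∀ i, IsHolderFun γ (x i)) →
        ∃ X : I → H →ₗ[ℝ] ℝ, IsHopfHolderPath 𝒜 b γ X ∧
          ∀ i t, X t (b 1 i : H) = x i t - x i 0) ∧
    (∀ (d : ℕ) (x : Fin d → I → ℝ), (∀ i, IsHolderFun γ (x i)) →
        ∃ X : I → I → WithConv (BCK (Fin d) →ₐ[ℝ] ℝ), IsBranchedRoughPath γ X ∧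
          ∀ i s t, (X s t).ofConv (BCK.tree (DecTree.single i)) = x i t - x i s) := by
  refine ⟨?_, fun d x hx => BCK.exists_branchedRoughPath hγ0 hγ x hx⟩
  intro H _ _ 𝒜 _ _ b x hx
  exact exists_hopfHolderPath 𝒜 b hγ0 hγ1 hγ x hx
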